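/- **Networks.** A ReLU network with $\ell\ge 1$ hidden layers, layer sizes $m_0,\dots,m_\ell\ge 1$ and a single output node ($m_{\ell+1}=1$) is a tuple $(W_0,\dots,W_\ell)$ of matrices $W_i\in[-1,1]^{m_{i+1}\times m_i}$. With $\mathrm{ReLU}(y)=\max\{0,y\}$ applied coordinatewise, put $f_0(x)=x$ and $f_{i+1}(x)=W_i\,\mathrm{ReLU}(f_i(x))$ for $x\in\{0,1\}^{m_0}$; the network computes $f:\{0,1\}^{m_0}\to\{0,1\}$ with $f(x)=1$ iff $f_{\ell+1}(x)>0$. It is $(\epsilon,\delta)$-close to computing a function $F$ if each $W_i$ can be changed in at most $\epsilon m_i m_{i+1}$ places so that the result is a ReLU network computing some $g$ with $\Pr_x[g(x)\ne F(x)]\le\delta$ ($x$ uniform in $\{0,1\}^{m_0}$), and $(\epsilon,\delta)$-far otherwise. The OR-function takes the value $1$ at every $x\neq 0$ and $0$ at $x=0$. **Testers.** Let $L=\ln\frac{1}{\lambda\epsilon}$. Given constants $c_0,\dots,c_\ell>0$, let $\bar s_0=\lceil c_0\epsilon^{-2\ell}L\rceil$, $\bar s_k=\lceil c_k\epsilon^{-4\ell}L^2\rceil$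 for $1\le k\le\ell$, and $s_k=\min\{\bar s_k,m_k\}$. The tester AllZeroTesterMHL samples, independently for $0\le k\le\ell$, a set of $s_k$ nodes of layer $k$ uniformly at random without replacement, with diagonal $0/1$ sampling matrices $S_k$, and queries the weights of all edges of the subnetwork induced by the sampled nodes and the output node. With $h_0(x)=x$ and $h_{i+1}(x)=W_iS_i\,\mathrm{ReLU}(h_i(x))$, whose final value $h_{\ell+1}(x)$ is determined by the queried weights, it rejects if some $x\in\{0,1\}^{m_0}$ satisfies $$\prod_{i=0}^{\ell}\frac{m_i}{s_i}\,h_{\ell+1}(x)-\frac1{16}\Big(\frac{\epsilon}{2}\Big)^{\ell}\prod_{i=0}^{\ell}m_i>0,$$ and accepts otherwise. ORTesterMHL is the same, except that it rejects iff some $x$ satisfies $\prod_{i}\frac{m_i}{s_i}h_{\ell+1}(x)+\frac1{16}(\epsilon/2)^{\ell}\prod_{i}m_i<0$. **Theorem.** For every $\ell\ge1$ there are constants $c_0,\dots,c_\ell,a,b>0$, depending only on $\ell$, such that the following holds for all $\lambda,\epsilon$ with $0<\lambda<\frac1{\ell+1}$ and $\frac{1}{\min_{0\le k\le\ell}m_k}<\epsilon<\frac12$.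 1. (Queries.) For every outcome of its random choices, each of the two testers queries at most $b\,\epsilon^{-8\ell}L^4$ entries of $W_0,\dots,W_\ell$. If $\bar s_k\le m_k$ for all $0\le k\le\ell$ and $\ell\ge2$, it queries at least $a\,\epsilon^{-8\ell}L^4$ entries, so the number of queries is $\Theta(\epsilon^{-8\ell}\ln^4(1/\lambda\epsilon))$. For $\ell=1$ the number of queries is at most $b\,\epsilon^{-6}L^3$, and at least $a\,\epsilon^{-6}L^3$ if $\bar s_k\le m_k$ for all $k$. 2. (Correctness.) Let $0<\lambda^*<\frac1{\ell+1}$, and suppose that $m_0\ge128(\ell+1)^2(2/\epsilon)^{2\ell}\ln\big(\frac1{\lambda^*}\prod_{i=1}^{\ell}m_i\big)$, that $m_k\ge171(\ell+1)^2(2/\epsilon)^{2\ell}\ln\big(\frac1{\lambda^*}\prod_{i=k+1}^{\ell}m_i\big)$ for every $1\le k\le\ell$, and that $\delta\ge\lambda^*+e^{-m_0/16}$. Then, for every ReLU network with these layer sizes and a single output node, AllZeroTesterMHL rejects with probability at least $1-\lambda$ if the network is $(\epsilon,\delta)$-far from computing the constant $0$-function, and accepts with probability at least $1-\lambda$ if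 the network computes the constant $0$-function. Likewise ORTesterMHL rejects with probability at least $1-\lambda$ if the network is $(\epsilon,\delta)$-far from computing the OR-function, and accepts with probability at least $1-\lambda$ if it computes the OR-function. 3. (Simplified form.) If $m_0=\dots=m_\ell=n$, the conclusions of 2 for both testers also hold under the assumptions $\delta\ge e^{-n/16}+e^{-(\epsilon/2)^{\ell}n/(342(\ell+1)^2)}$ and $n\ge171(\ell+1)^2(2/\epsilon)^{2\ell}\big(\ln(2/\delta)+\ell\ln n\big)$ in place of those on $\lambda^*$, on the $m_k$ and on $\delta$. -/

import Mathlib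

namespace ReLUTest

/-! ### ReLU networks with `ℓ` hidden layers

Layers are numbered `0, …, ℓ + 1`; layer `k` has `m k` nodes, layer `0` is the input layer and layer
`Fin.last (ℓ + 1)` is the output layer. -/

/-- Arrays of real matrices `W_0, …, W_ℓ`, where `W_i` has `m_{i+1}` rows and `m_i` columns. -/
abbrev Weights {ℓ : ℕ} (m : Fin (ℓ + 2) → ℕ) : Type :=
  (i : Fin (ℓ + 1)) → Matrix (Fin (m i.succ)) (Fin (m i.castSucc)) ℝ

/-- A ReLU network: matrices `W_0, …, W_ℓ` all of whose entries lie in `[-1, 1]`. -/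
structure ReLUNetwork {ℓ : ℕ} (m : Fin (ℓ + 2) → ℕ) where
  W : Weights m
  bounded : ∀ i j k, W i j k ∈ Set.Icc (-1 : ℝ) 1

/-- The ReLU activation function, applied coordinatewise. -/
noncomputable def relu {ι : Type} (v : ι → ℝ) : ι → ℝ := fun j => max 0 (v j)

/-- Inputs `x ∈ {0,1}^{m_0}`. -/
abbrev Input {ℓ : ℕ} (m : Fin (ℓ + 2) → ℕ) : Type := Fin (m 0) → Bool

/-- Outputs in `{0,1}^{m_{ℓ+1}}`. -/
abbrev Output {ℓ : ℕ} (m : Fin (ℓ + 2) → ℕ) : Type := Fin (m (Fin.last (ℓ + 1))) → Bool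

/-- A binary input as a real vector. -/
def inputVector {ℓ : ℕ} {m : Fin (ℓ + 2) → ℕ} (x : Input m) : Fin (m 0) → ℝ :=
  fun i => if x i then 1 else 0

/-- The vector `f_k(x)` of values at layer `k`:
`f_0(x) = x` and `f_{i+1}(x) = W_i · relu(f_i(x))`. -/
noncomputable def layerValue {ℓ : ℕ} {m : Fin (ℓ + 2) → ℕ} (W : Weights m) (x : Input m)
    (k : Fin (ℓ + 2)) : Fin (m k) → ℝ :=
  Fin.induction (motive := fun k => Fin (m k) → ℝ) (inputVector x)
    (fun i v => (W i).mulVec (relu v)) k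

/-- The Boolean function computed by a network: an output node outputs `1` iff its value is positive,
that is, it outputs `sign(relu(f_{ℓ+1}(x)))`. -/
noncomputable def ReLUNetwork.computed {ℓ : ℕ} {m : Fin (ℓ + 2) → ℕ} (N : ReLUNetwork m) :
    Input m → Output m :=
  fun x j => decide (0 < layerValue N.W x (Fin.last (ℓ + 1)) j)

/-- The constant `0`-function. -/
def zeroFunction {ℓ : ℕ} (m : Fin (ℓ + 2) → ℕ) : Input m → Output m := fun _ _ => false

/-- The OR-function: `1` iff some input bit is `1`. -/
def orFunction {ℓ : ℕ} (m : Fin (ℓ + 2) → ℕ) : Input m → Output m :=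
  fun x _ => decide (∃ i, x i = true)

/-! ### Distance -/

/-- `Pr[g(x) ≠ f(x)]` for `x` uniform in `{0,1}^{m_0}`. -/
noncomputable def disagreement {ℓ : ℕ} {m : Fin (ℓ + 2) → ℕ} (g f : Input m → Output m) : ℝ :=
  ((Finset.univ.filter fun x => g x ≠ f x).card : ℝ) / 2 ^ (m 0)

/-- `N` is `(ε, δ)`-close to computing `f`: every `W_i` can be changed in at most `ε m_i m_{i+1}`
places so that the resulting ReLU network computes a function `g` with `Pr[g(x) ≠ f(x)] ≤ δ`. -/
def IsClose {ℓ : ℕ} {m : Fin (ℓ + 2) → ℕ} (ε δ : ℝ) (N : ReLUNetwork m)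
    (f : Input m → Output m) : Prop :=
  ∃ N' : ReLUNetwork m,
    (∀ i, ((Finset.univ.filter fun p : Fin (m i.succ) × Fin (m i.castSucc) =>
        N'.W i p.1 p.2 ≠ N.W i p.1 p.2).card : ℝ) ≤ ε * m i.castSucc * m i.succ) ∧
    disagreement N'.computed f ≤ δ

/-- `N` is `(ε, δ)`-far from computing `f`. -/
def IsFar {ℓ : ℕ} {m : Fin (ℓ + 2) → ℕ} (ε δ : ℝ) (N : ReLUNetwork m)
    (f : Input m → Output m) : Prop :=
  ¬ IsClose ε δ N f

/-! ### Testers with query access to the weights -/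

/-- The positions that can be queried: `⟨i, j, k⟩` is the entry `W_i[j, k]`. -/
abbrev Edge {ℓ : ℕ} (m : Fin (ℓ + 2) → ℕ) : Type :=
  (i : Fin (ℓ + 1)) × (Fin (m i.succ) × Fin (m i.castSucc))

/-- The answer of a network to a query. -/
def ReLUNetwork.answer {ℓ : ℕ} {m : Fin (ℓ + 2) → ℕ} (N : ReLUNetwork m) (e : Edge m) : ℝ :=
  N.W e.1 e.2.1 e.2.2

/-- A randomized (non-adaptive) tester. It draws random coins, queries the positions `queries ω`,
and decides on the basis of the coins and of the answers to these queries only. -/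
structure Tester {ℓ : ℕ} (m : Fin (ℓ + 2) → ℕ) where
  Coins : Type
  coins : PMF Coins
  queries : Coins → Finset (Edge m)
  accepts : (ω : Coins) → ({e : Edge m // e ∈ queries ω} → ℝ) → Prop

/-- The tester accepts the network `N` when its coins are `ω`. -/
def Tester.AcceptsOn {ℓ : ℕ} {m : Fin (ℓ + 2) → ℕ} (T : Tester m) (N : ReLUNetwork m)
    (ω : T.Coins) : Prop :=
  T.accepts ω (fun e => N.answer e.1)

/-- The probability that the tester accepts `N`. -/
noncomputable def Tester.acceptProb {ℓ : ℕ} {m : Fin (ℓ + 2) → ℕ} (T : Tester m)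
    (N : ReLUNetwork m) : ℝ :=
  (T.coins.toOuterMeasure {ω | T.AcceptsOn N ω}).toReal

/-- The probability that the tester rejects `N`. -/
noncomputable def Tester.rejectProb {ℓ : ℕ} {m : Fin (ℓ + 2) → ℕ} (T : Tester m)
    (N : ReLUNetwork m) : ℝ :=
  (T.coins.toOuterMeasure {ω | ¬ T.AcceptsOn N ω}).toReal

/-! ### The sampled subnetwork -/

/-- A choice of node sets `𝕊_0, …, 𝕊_ℓ` in the layers `0, …, ℓ`. -/
abbrev NodeSample {ℓ : ℕ} (m : Fin (ℓ + 2) → ℕ) : Type :=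
  (i : Fin (ℓ + 1)) → Finset (Fin (m i.castSucc))

/-- The prescribed sample sizes (before they are compared with the layer sizes):
`c_0 ε^{-2ℓ} ln(1/(λε))` for layer `0` and `c_k ε^{-4ℓ} ln²(1/(λε))` for layers `1 ≤ k ≤ ℓ`,
rounded up. -/
noncomputable def nominalSize {ℓ : ℕ} (c : Fin (ℓ + 1) → ℝ) (ε lam : ℝ) (k : Fin (ℓ + 1)) : ℕ :=
  if k = 0 then ⌈c k * (1 / ε) ^ (2 * ℓ) * Real.log (1 / (lam * ε))⌉₊
  else ⌈c k * (1 / ε) ^ (4 * ℓ) * Real.log (1 / (lam * ε)) ^ 2⌉₊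

/-- The sample sizes `s_0, …, s_ℓ`: a layer with fewer nodes than prescribed is taken as a whole. -/
noncomputable def sampleSize {ℓ : ℕ} (m : Fin (ℓ + 2) → ℕ) (c : Fin (ℓ + 1) → ℝ) (ε lam : ℝ)
    (k : Fin (ℓ + 1)) : ℕ :=
  min (nominalSize c ε lam k) (m k.castSucc)

/-- All choices of node sets with `|𝕊_k| = s_k`. -/
noncomputable def samples {ℓ : ℕ} (m : Fin (ℓ + 2) → ℕ) (c : Fin (ℓ + 1) → ℝ) (ε lam : ℝ) :
    Finset (NodeSample m) :=
  Fintype.piFinset fun k =>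
    Finset.powersetCard (sampleSize m c ε lam k) (Finset.univ : Finset (Fin (m k.castSucc)))

theorem samples_nonempty {ℓ : ℕ} (m : Fin (ℓ + 2) → ℕ) (c : Fin (ℓ + 1) → ℝ) (ε lam : ℝ) :
    (samples m c ε lam).Nonempty := by
  refine Fintype.piFinset_nonempty.2 fun k => Finset.powersetCard_nonempty.2 ?_
  rw [Finset.card_univ, Fintype.card_fin]
  exact min_le_right _ _

/-- The node set used in each layer: `𝕊_k` in the layers `0, …, ℓ`, and all output nodes. -/
def usedNodes {ℓ : ℕ} {m : Fin (ℓ + 2) → ℕ} (S : NodeSample m) (k : Fin (ℓ + 2)) :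
    Finset (Fin (m k)) :=
  Fin.lastCases (motive := fun k => Finset (Fin (m k))) Finset.univ S k

/-- The edges of the subnetwork induced by `𝕊_0, …, 𝕊_ℓ` and the output nodes. -/
def inducedEdges {ℓ : ℕ} {m : Fin (ℓ + 2) → ℕ} (S : NodeSample m) : Finset (Edge m) :=
  Finset.univ.filter fun e => e.2.1 ∈ usedNodes S e.1.succ ∧ e.2.2 ∈ S e.1

/-- The weights known after querying `Q` (unknown entries are filled with `0`). -/
def knownWeights {ℓ : ℕ} {m : Fin (ℓ + 2) → ℕ} (Q : Finset (Edge m))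
    (a : {e : Edge m // e ∈ Q} → ℝ) : Weights m :=
  fun i j k => if h : (⟨i, (j, k)⟩ : Edge m) ∈ Q then a ⟨⟨i, (j, k)⟩, h⟩ else 0

/-- The diagonal sampling matrix of a set of nodes. -/
def samplingMatrix {n : ℕ} (S : Finset (Fin n)) : Matrix (Fin n) (Fin n) ℝ :=
  Matrix.diagonal fun j => if j ∈ S then 1 else 0

/-- `h_k(x)`, where `h_0(x) = x` and `h_{i+1}(x) = W_i · S_i · relu(h_i(x))`. -/
noncomputable def sampledValue {ℓ : ℕ} {m : Fin (ℓ + 2) → ℕ} (W : Weights m) (S : NodeSample m)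
    (x : Input m) (k : Fin (ℓ + 2)) : Fin (m k) → ℝ :=
  layerValue (fun i => W i * samplingMatrix (S i)) x k

/-- The scaled value `∏_{i=0}^{ℓ} (m_i / s_i) · h_{ℓ+1}(x)` at the output node `j`. -/
noncomputable def scaledOutput {ℓ : ℕ} {m : Fin (ℓ + 2) → ℕ} (s : Fin (ℓ + 1) → ℕ) (W : Weights m)
    (S : NodeSample m) (x : Input m) (j : Fin (m (Fin.last (ℓ + 1)))) : ℝ :=
  (∏ i : Fin (ℓ + 1), (m i.castSucc : ℝ) / (s i : ℝ)) * sampledValue W S x (Fin.last (ℓ + 1)) j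

/-- The bias `(1/16) · (ε/2)^ℓ · ∏_{i=0}^{ℓ} m_i`. -/
noncomputable def bias {ℓ : ℕ} (m : Fin (ℓ + 2) → ℕ) (ε : ℝ) : ℝ :=
  1 / 16 * (ε / 2) ^ ℓ * ∏ i : Fin (ℓ + 1), (m i.castSucc : ℝ)

/-- The rejection condition of the tester for the constant `0`-function. -/
def ZeroRejects {ℓ : ℕ} {m : Fin (ℓ + 2) → ℕ} (s : Fin (ℓ + 1) → ℕ) (ε : ℝ) (W : Weights m)
    (S : NodeSample m) : Prop :=
  ∃ x : Input m, ∃ j, scaledOutput s W S x j - bias m ε > 0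

/-- The rejection condition of the tester for the OR-function. -/
def OrRejects {ℓ : ℕ} {m : Fin (ℓ + 2) → ℕ} (s : Fin (ℓ + 1) → ℕ) (ε : ℝ) (W : Weights m)
    (S : NodeSample m) : Prop :=
  ∃ x : Input m, ∃ j, scaledOutput s W S x j + bias m ε < 0

/-- `AllZeroTesterMHL`: sample `s_k` nodes of each layer `0 ≤ k ≤ ℓ` independently, uniformly and
without replacement, query the induced subnetwork, and reject iff `ZeroRejects`. -/
noncomputable def allZeroTesterMHL {ℓ : ℕ} (m : Fin (ℓ + 2) → ℕ) (c : Fin (ℓ + 1) → ℝ)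
    (ε lam : ℝ) : Tester m where
  Coins := NodeSample m
  coins := PMF.uniformOfFinset (samples m c ε lam) (samples_nonempty m c ε lam)
  queries := inducedEdges
  accepts := fun S a =>
    ¬ ZeroRejects (sampleSize m c ε lam) ε (knownWeights (inducedEdges S) a) S

/-- `ORTesterMHL`: the same with the rejection condition `OrRejects`. -/
noncomputable def orTesterMHL {ℓ : ℕ} (m : Fin (ℓ + 2) → ℕ) (c : Fin (ℓ + 1) → ℝ)
    (ε lam : ℝ) : Tester m where
  Coins := NodeSample m
  coins := PMF.uniformOfFinset (samples m c ε lam) (samples_nonempty m c ε lam)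
  queries := inducedEdges
  accepts := fun S a =>
    ¬ OrRejects (sampleSize m c ε lam) ε (knownWeights (inducedEdges S) a) S

/-! The decision, although it reads only the queried entries, is the one made with the full weight
matrices in the recursion for `h_k`. -/

theorem sampledValue_knownWeights {ℓ : ℕ} {m : Fin (ℓ + 2) → ℕ} (N : ReLUNetwork m)
    (S : NodeSample m) (x : Input m) (k : Fin (ℓ + 2)) :
    ∀ j ∈ usedNodes S k,
      sampledValue (knownWeights (inducedEdges S) fun e => N.answer e.1) S x k j
        = sampledValue N.W S x k j := by
  induction k using Fin.induction with
  | zero => intro j _; rfl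
  | succ i ih =>
    intro j hj
    have hS : usedNodes S i.castSucc = S i := by simp [usedNodes]
    rw [hS] at ih
    simp only [sampledValue, layerValue, Fin.induction_succ] at ih ⊢
    simp only [Matrix.mulVec, dotProduct]
    refine Finset.sum_congr rfl fun t _ => ?_
    simp only [samplingMatrix, Matrix.mul_diagonal]
    by_cases ht : t ∈ S i
    · have hmem : (⟨i, (j, t)⟩ : Edge m) ∈ inducedEdges S := by
        simp [inducedEdges, hj, ht]
      have h1 : knownWeights (inducedEdges S) (fun e => N.answer e.1) i j t = N.W i j t := by
        simp [knownWeights, hmem, ReLUNetwork.answer]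
      have h2 := ih t ht
      simp only [samplingMatrix] at h2
      rw [h1, relu, relu, h2]
    · simp [ht]

theorem scaledOutput_knownWeights {ℓ : ℕ} {m : Fin (ℓ + 2) → ℕ} (s : Fin (ℓ + 1) → ℕ)
    (N : ReLUNetwork m) (S : NodeSample m) (x : Input m) (j : Fin (m (Fin.last (ℓ + 1)))) :
    scaledOutput s (knownWeights (inducedEdges S) fun e => N.answer e.1) S x j
      = scaledOutput s N.W S x j := by
  have hj : j ∈ usedNodes S (Fin.last (ℓ + 1)) := by simp [usedNodes]
  rw [scaledOutput, scaledOutput, sampledValue_knownWeights N S x _ j hj]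

theorem allZeroTesterMHL_acceptsOn {ℓ : ℕ} (m : Fin (ℓ + 2) → ℕ) (c : Fin (ℓ + 1) → ℝ)
    (ε lam : ℝ) (N : ReLUNetwork m) (S : NodeSample m) :
    (allZeroTesterMHL m c ε lam).AcceptsOn N S
      ↔ ¬ ZeroRejects (sampleSize m c ε lam) ε N.W S := by
  simp only [Tester.AcceptsOn, allZeroTesterMHL, ZeroRejects, scaledOutput_knownWeights]

theorem orTesterMHL_acceptsOn {ℓ : ℕ} (m : Fin (ℓ + 2) → ℕ) (c : Fin (ℓ + 1) → ℝ)
    (ε lam : ℝ) (N : ReLUNetwork m) (S : NodeSample m) :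
    (orTesterMHL m c ε lam).AcceptsOn N S
      ↔ ¬ OrRejects (sampleSize m c ε lam) ε N.W S := by
  simp only [Tester.AcceptsOn, orTesterMHL, OrRejects, scaledOutput_knownWeights]

/-! ### The two parts of the claim -/

/-- `T` rejects `N` with probability at least `1 - λ` if `N` is `(ε, δ)`-far from computing `f`, and
accepts `N` with probability at least `1 - λ` if `N` computes `f`. -/
def Tests {ℓ : ℕ} {m : Fin (ℓ + 2) → ℕ} (T : Tester m) (f : Input m → Output m)
    (ε δ lam : ℝ) (N : ReLUNetwork m) : Prop :=
  (IsFar ε δ N f → 1 - lam ≤ T.rejectProb N) ∧ (N.computed = f → 1 - lam ≤ T.acceptProb N)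

/-- The number `q` of queries, as a function of `ε` and `λ`, with constants `a` and `b`: for `ℓ ≥ 2`
it is at most `b ε^{-8ℓ} ln⁴(1/(λε))`, and at least `a ε^{-8ℓ} ln⁴(1/(λε))` if no layer is smaller
than its prescribed sample (`enough`). For `ℓ = 1` the order is `ε^{-6} ln³(1/(λε))` instead. -/
def QueryBound (ℓ : ℕ) (a b ε lam : ℝ) (enough : Prop) (q : ℕ) : Prop :=
  ((q : ℝ) ≤ b * ((1 / ε) ^ (8 * ℓ) * Real.log (1 / (lam * ε)) ^ 4)) ∧
  (2 ≤ ℓ → enough → a * ((1 / ε) ^ (8 * ℓ) * Real.log (1 / (lam * ε)) ^ 4) ≤ (q : ℝ)) ∧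
  (ℓ = 1 →
    (q : ℝ) ≤ b * ((1 / ε) ^ 6 * Real.log (1 / (lam * ε)) ^ 3) ∧
    (enough → a * ((1 / ε) ^ 6 * Real.log (1 / (lam * ε)) ^ 3) ≤ (q : ℝ)))

/-- The lower bounds on the layer sizes, for layers of arbitrary sizes. -/
def LayersLarge {ℓ : ℕ} (m : Fin (ℓ + 2) → ℕ) (ε lamStar : ℝ) : Prop :=
  (128 * ((ℓ : ℝ) + 1) ^ 2 * (2 / ε) ^ (2 * ℓ) *
      Real.log (1 / lamStar * ∏ i ∈ Finset.Ioi (0 : Fin (ℓ + 1)), (m i.castSucc : ℝ))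
    ≤ (m 0 : ℝ)) ∧
  ∀ k : Fin (ℓ + 1), 1 ≤ k.val →
    171 * ((ℓ : ℝ) + 1) ^ 2 * (2 / ε) ^ (2 * ℓ) *
        Real.log (1 / lamStar * ∏ i ∈ Finset.Ioi k, (m i.castSucc : ℝ))
      ≤ (m k.castSucc : ℝ)

end ReLUTest

/-!
The testers are correct because of one estimate, used in two ways, and one modification of networks.

*Sampling.* Fix an input. Exact values at layer `k` are bounded by `layerProd m k = ∏_{i < k} m_i`. If, at
every sampled node, the sampled sum of the exact values of the preceding layer is accurate up to `η`
times this bound, then the errors of the sampled network only add up along the layers, since ReLU is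
`1`-Lipschitz (`abs_scaled_sampledValue_sub_le`). The sampled sums are accurate by Hoeffding's
inequality for sampling without replacement (`card_abs_sum_gt_le`). A union bound is needed only over
the *sampled* nodes of the next layer, so the sample sizes do not depend on the layer sizes.

*Acceptance.* The rejection condition quantifies over all inputs, but the sampled network depends only
on the restriction of the input to the `s_0` sampled input nodes. By positive homogeneity, its scaled
output estimates `m_0 / s_0` times the exact output at this restriction, without any error in the first
layer, and a union bound over `2 ^ s_0` inputs suffices (`card_exists_scaledOutput_restrict_le`). The
exact output has the right sign, so the scaled output does not pass the bias.

*Rejection.* If all outputs of a network, multiplied by a sign `σ`, are at most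
`(1/8) (ε/2)^ℓ ∏ m_i`, then the network is close to the function (`isClose_of_forall_le`): pick
`⌊(ε/2) m_k⌋` random nodes in every hidden layer, cut them off from the others and connect them to
a path that sends `-σ |x| ∏_k ⌊(ε/2) m_k⌋` to the output (`layerValue_pathWeights`). Deleting the nodes
from the rest of the network is again sampling and changes the scaled output by at most another
`(1/8) (ε/2)^ℓ ∏ m_i` for all but a fraction `λ*` of the inputs, while `|x| > (3/10) m_0` for all but a
fraction `e^(-m_0/16)`, so that the path dominates. Hence a far network has an input `x` whose output
exceeds twice the bias, and the sampled network sees this at the single input `x`.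
-/

namespace ReLUTest

open Finset

/-! ### Hoeffding's inequality for sampling without replacement -/

/-- An `(s + 1)`-element subset is a first element followed by an `s`-element subset of the rest;
every set arises in this way once for each of its elements. -/
lemma sum_powersetCard_succ {ι : Type*} [DecidableEq ι] (T : Finset ι) (s : ℕ)
    (F : Finset ι → ℝ) :
    ((s : ℝ) + 1) * ∑ S ∈ powersetCard (s + 1) T, F S
      = ∑ i ∈ T, ∑ S ∈ powersetCard s (T.erase i), F (insert i S) := by
  have h1 : ((s : ℝ) + 1) * ∑ S ∈ powersetCard (s + 1) T, F S
      = ∑ S ∈ powersetCard (s + 1) T, ∑ _i ∈ S, F S := by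
    rw [mul_sum]
    refine sum_congr rfl fun S hS => ?_
    rw [sum_const, (mem_powersetCard.1 hS).2, nsmul_eq_mul]
    push_cast
    rfl
  rw [h1, sum_sigma', sum_sigma']
  refine sum_bij' (fun p _ => ⟨p.2, p.1.erase p.2⟩) (fun p _ => ⟨insert p.1 p.2, p.1⟩)
    ?_ ?_ ?_ ?_ ?_
  · rintro ⟨S, i⟩ h
    simp only [mem_sigma, mem_powersetCard] at h ⊢
    exact ⟨h.1.1 h.2, erase_subset_erase _ h.1.1, by rw [card_erase_of_mem h.2, h.1.2]; rfl⟩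
  · rintro ⟨i, S⟩ h
    simp only [mem_sigma, mem_powersetCard] at h ⊢
    have hi : i ∉ S := fun hi => by simpa using h.2.1 hi
    refine ⟨⟨insert_subset h.1 (h.2.1.trans (erase_subset _ _)), ?_⟩, mem_insert_self _ _⟩
    rw [card_insert_of_notMem hi, h.2.2]
  · rintro ⟨S, i⟩ h
    simp only [mem_sigma] at h
    simp [insert_erase h.2]
  · rintro ⟨i, S⟩ h
    simp only [mem_sigma, mem_powersetCard] at h
    have hi : i ∉ S := fun hi => by simpa using h.2.1 hi
    simp [erase_insert hi]
  · rintro ⟨S, i⟩ h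
    simp only [mem_sigma] at h
    simp [insert_erase h.2]

/-- Hoeffding's lemma for the uniform distribution on a finite set. -/
lemma sum_exp_sub_mean_le {ι : Type*} (T : Finset ι) (hT : T.Nonempty) (v : ι → ℝ) {B : ℝ}
    (hv : ∀ i ∈ T, |v i| ≤ B) (θ : ℝ) :
    ∑ i ∈ T, Real.exp (θ * (v i - (∑ t ∈ T, v t) / #T)) ≤ #T * Real.exp (θ ^ 2 * B ^ 2 / 2) := by
  classical
  let : MeasurableSpace T := ⊤
  have : Nonempty T := hT.to_subtype
  have hT0 : (0 : ℝ) < #T := by exact_mod_cast hT.card_pos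
  let μ := (PMF.uniformOfFintype T).toMeasure
  have hsub := ProbabilityTheory.hasSubgaussianMGF_of_mem_Icc (μ := μ) (X := fun i : T => v i)
    (a := -B) (b := B) measurable_from_top.aemeasurable (Filter.Eventually.of_forall fun i => abs_le.1 (hv i i.2))
  have hint : ∀ g : ι → ℝ, ∫ i : T, g i ∂μ = (∑ i ∈ T, g i) / #T := by
    intro g
    rw [PMF.integral_eq_sum, ← sum_coe_sort T, div_eq_inv_mul, mul_sum]
    refine sum_congr rfl fun i _ => ?_
    simp [PMF.uniformOfFintype_apply]
  have h := hsub.mgf_le θ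
  rw [hint v] at h
  unfold ProbabilityTheory.mgf at h
  rw [hint (fun i => Real.exp (θ * (v i - (∑ t ∈ T, v t) / #T))), div_le_iff₀ hT0] at h
  refine h.trans (le_of_eq ?_)
  rw [mul_comm]
  congr 2
  simp only [NNReal.coe_pow, NNReal.coe_div, coe_nnnorm, NNReal.coe_ofNat, Real.norm_eq_abs]
  rw [div_pow, sq_abs]
  ring

/-- The moment generating function of the sum over a random `s`-element subset is at most that of
`s` independent samples. Given the first element `i`, the expected total changes only by
`κ (v i - mean)` with `0 ≤ κ ≤ 1`, which allows an induction on `s`. -/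
lemma sum_exp_powersetCard_le {ι : Type*} [DecidableEq ι] (v : ι → ℝ) {B : ℝ} (θ : ℝ) (s : ℕ) :
    ∀ T : Finset ι, (∀ i ∈ T, |v i| ≤ B) → s ≤ #T →
      ∑ S ∈ powersetCard s T, Real.exp (θ * (∑ i ∈ S, v i - s / #T * ∑ i ∈ T, v i))
        ≤ (#T).choose s * Real.exp (s * (θ ^ 2 * B ^ 2 / 2)) := by
  induction s with
  | zero => intro T _ _; simp
  | succ s ih =>
    intro T hv hs
    obtain ⟨n, hn⟩ : ∃ n, #T = n + 1 := ⟨#T - 1, by omega⟩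
    have hT : T.Nonempty := card_pos.1 (by omega)
    have hsn : s ≤ n := by omega
    set κ : ℝ := 1 - s / n with hκ
    have hκ1 : κ ≤ 1 := by
      have : (0 : ℝ) ≤ s / n := by positivity
      linarith
    have hκ0 : 0 ≤ κ := by
      have : (s : ℝ) / n ≤ 1 := div_le_one_of_le₀ (by exact_mod_cast hsn) (by positivity)
      linarith
    set Q : ℝ := θ ^ 2 * B ^ 2 / 2 with hQ
    have hrest : ∀ i ∈ T, ∑ S ∈ powersetCard s (T.erase i),
        Real.exp (θ * (∑ t ∈ insert i S, v t - ((s + 1 : ℕ) : ℝ) / #T * ∑ t ∈ T, v t))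
        ≤ Real.exp (θ * κ * (v i - (∑ t ∈ T, v t) / #T)) * (n.choose s * Real.exp (s * Q)) := by
      intro i hi
      have hc : #(T.erase i) = n := by rw [card_erase_of_mem hi, hn]; rfl
      have h := ih (T.erase i) (fun t ht => hv t (mem_of_mem_erase ht)) (by omega)
      rw [hc] at h
      refine le_trans (le_of_eq ?_) (mul_le_mul_of_nonneg_left h
        (Real.exp_pos (θ * κ * (v i - (∑ t ∈ T, v t) / #T))).le)
      rw [mul_sum (powersetCard s (T.erase i))]
      refine sum_congr rfl fun S hS => ?_
      have hiS : i ∉ S := fun h' => by simpa using (mem_powersetCard.1 hS).1 h'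
      rw [← Real.exp_add, sum_insert hiS, ← sum_erase_add T v hi, hn, hκ]
      congr 1
      push_cast
      rcases Nat.eq_zero_or_pos n with h0 | h0
      · have hs0 : s = 0 := by omega
        subst h0; subst hs0
        simp; ring
      · have hn0 : (n : ℝ) ≠ 0 := by positivity
        field_simp
        ring
    have hfirst := sum_exp_sub_mean_le T hT v hv (θ * κ)
    have hbig : Real.exp ((θ * κ) ^ 2 * B ^ 2 / 2) ≤ Real.exp Q := by
      refine Real.exp_le_exp.2 ?_
      rw [hQ, mul_pow]
      have : κ ^ 2 ≤ 1 := pow_le_one₀ hκ0 hκ1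
      nlinarith [mul_nonneg (sq_nonneg θ) (sq_nonneg B)]
    have hchoose : ((n : ℝ) + 1) * n.choose s = (n + 1).choose (s + 1) * ((s : ℝ) + 1) := by
      exact_mod_cast Nat.add_one_mul_choose_eq n s
    have hs1 : (0 : ℝ) < (s : ℝ) + 1 := by positivity
    refine le_of_mul_le_mul_left ?_ hs1
    rw [sum_powersetCard_succ]
    calc _ ≤ ∑ i ∈ T, Real.exp (θ * κ * (v i - (∑ t ∈ T, v t) / #T)) *
            (n.choose s * Real.exp (s * Q)) := sum_le_sum hrest
      _ ≤ (#T * Real.exp Q) * (n.choose s * Real.exp (s * Q)) := by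
          rw [← sum_mul]
          refine mul_le_mul_of_nonneg_right (hfirst.trans ?_) (by positivity)
          exact mul_le_mul_of_nonneg_left hbig (by positivity)
      _ = (((n : ℝ) + 1) * n.choose s) * (Real.exp Q * Real.exp (s * Q)) := by
          rw [hn]; push_cast; ring
      _ = _ := by
          rw [hchoose, ← Real.exp_add, hn, mul_comm _ ((s : ℝ) + 1), mul_assoc]
          congr 4
          push_cast; ring

lemma card_sum_gt_le {ι : Type*} [DecidableEq ι] (T : Finset ι) (v : ι → ℝ) {B t r : ℝ} {a : ℕ}
    (hv : ∀ i ∈ T, |v i| ≤ B) (ha : a ≤ #T) (hB : 0 < B) (ht : 0 ≤ t) (hr : 0 < r)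
    (har : (a : ℝ) ≤ r) :
    (#{S ∈ powersetCard a T | t < ∑ i ∈ S, v i - a / #T * ∑ i ∈ T, v i} : ℝ)
      ≤ Real.exp (-(t ^ 2 / (2 * r * B ^ 2))) * (#T).choose a := by
  -- the minimizer of the Chernoff exponent `-θ t + r θ² B² / 2`
  set θ : ℝ := t / (r * B ^ 2) with hθ
  have hθ0 : 0 ≤ θ := by positivity
  have hmgf := sum_exp_powersetCard_le v θ a T hv ha
  have hmarkov : (#{S ∈ powersetCard a T | t < ∑ i ∈ S, v i - a / #T * ∑ i ∈ T, v i} : ℝ)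
      * Real.exp (θ * t)
      ≤ ∑ S ∈ powersetCard a T, Real.exp (θ * (∑ i ∈ S, v i - a / #T * ∑ i ∈ T, v i)) := by
    rw [← nsmul_eq_mul, ← sum_const]
    refine (sum_le_sum fun S hS => ?_).trans
      (sum_le_sum_of_subset_of_nonneg (filter_subset _ _) fun S _ _ => (Real.exp_pos _).le)
    exact Real.exp_le_exp.2 (mul_le_mul_of_nonneg_left (mem_filter.1 hS).2.le hθ0)
  have hle : (a : ℝ) * (θ ^ 2 * B ^ 2 / 2) ≤ r * (θ ^ 2 * B ^ 2 / 2) :=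
    mul_le_mul_of_nonneg_right har (by positivity)
  have hexp : -(t ^ 2 / (2 * r * B ^ 2)) = r * (θ ^ 2 * B ^ 2 / 2) - θ * t := by
    rw [hθ]; field_simp; ring
  rw [hexp, Real.exp_sub, div_mul_eq_mul_div _ _ (((#T).choose a : ℕ) : ℝ),
    le_div_iff₀ (Real.exp_pos _)]
  refine (hmarkov.trans hmgf).trans ?_
  rw [mul_comm]
  exact mul_le_mul_of_nonneg_right (Real.exp_le_exp.2 hle) (by positivity)

/-- **Hoeffding's inequality** for a uniformly random `a`-element subset of `T`. The bound is stated
with an upper bound `r` for the sample size. -/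
lemma card_abs_sum_gt_le {ι : Type*} [DecidableEq ι] (T : Finset ι) (v : ι → ℝ) {B t r : ℝ} {a : ℕ}
    (hv : ∀ i ∈ T, |v i| ≤ B) (ha : a ≤ #T) (hB : 0 < B) (ht : 0 ≤ t) (hr : 0 < r)
    (har : (a : ℝ) ≤ r) :
    (#{S ∈ powersetCard a T | t < |∑ i ∈ S, v i - a / #T * ∑ i ∈ T, v i|} : ℝ)
      ≤ 2 * Real.exp (-(t ^ 2 / (2 * r * B ^ 2))) * (#T).choose a := by
  have h1 := card_sum_gt_le T v hv ha hB ht hr har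
  have h2 := card_sum_gt_le T (fun i => -v i) (by simpa using hv) ha hB ht hr har
  have hsub : {S ∈ powersetCard a T | t < |∑ i ∈ S, v i - a / #T * ∑ i ∈ T, v i|}
      ⊆ {S ∈ powersetCard a T | t < ∑ i ∈ S, v i - a / #T * ∑ i ∈ T, v i}
        ∪ {S ∈ powersetCard a T | t < ∑ i ∈ S, -v i - a / #T * ∑ i ∈ T, -v i} := by
    intro S hS
    simp only [mem_union, mem_filter, sum_neg_distrib] at hS ⊢
    rcases lt_abs.1 hS.2 with h | h
    · exact Or.inl ⟨hS.1, h⟩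
    · exact Or.inr ⟨hS.1, by linarith⟩
  have h3 : (#{S ∈ powersetCard a T | t < |∑ i ∈ S, v i - a / #T * ∑ i ∈ T, v i|} : ℝ)
      ≤ #{S ∈ powersetCard a T | t < ∑ i ∈ S, v i - a / #T * ∑ i ∈ T, v i}
        + #{S ∈ powersetCard a T | t < ∑ i ∈ S, -v i - a / #T * ∑ i ∈ T, -v i} := by
    exact_mod_cast (card_le_card hsub).trans (card_union_le _ _)
  linarith

/-! ### Independent choices -/

/-- If, for every choice of the other coordinates, at most a fraction `p` of the choices of
coordinate `i` is bad, then at most a fraction `p` of all choices is bad. -/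
lemma card_filter_piFinset_le {ι : Type*} [Fintype ι] [DecidableEq ι] {α : ι → Type*}
    (t : ∀ i, Finset (α i)) (i : ι) (bad : (∀ i, α i) → Prop)
    [DecidablePred bad] (p : ℝ)
    (h : ∀ S ∈ Fintype.piFinset t,
      (#{T ∈ t i | bad (Function.update S i T)} : ℝ) ≤ p * #(t i)) :
    (#{S ∈ Fintype.piFinset t | bad S} : ℝ) ≤ p * #(Fintype.piFinset t) := by
  rcases (t i).eq_empty_or_nonempty with h0 | h0
  · have : Fintype.piFinset t = ∅ := Fintype.piFinset_eq_empty.2 ⟨i, h0⟩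
    simp [this]
  have hpos : (0 : ℝ) < #(t i) := by exact_mod_cast h0.card_pos
  -- exchanging coordinate `i` with the resampled value is an involution on pairs
  have hswap : ∑ S ∈ Fintype.piFinset t, ∑ T ∈ t i,
        (if bad (Function.update S i T) then (1 : ℝ) else 0)
      = ∑ S ∈ Fintype.piFinset t, ∑ T ∈ t i, (if bad S then (1 : ℝ) else 0) := by
    rw [← sum_product', ← sum_product']
    have hmem : ∀ q ∈ Fintype.piFinset t ×ˢ t i,
        (Function.update q.1 i q.2, q.1 i) ∈ Fintype.piFinset t ×ˢ t i := by
      rintro ⟨S, T⟩ hq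
      simp only [mem_product, Fintype.mem_piFinset] at hq ⊢
      refine ⟨fun k => ?_, hq.1 i⟩
      rcases eq_or_ne k i with rfl | hk
      · simpa using hq.2
      · simpa [hk] using hq.1 k
    refine sum_bij' (fun q _ => (Function.update q.1 i q.2, q.1 i))
      (fun q _ => (Function.update q.1 i q.2, q.1 i)) hmem hmem ?_ ?_ ?_ <;>
    · rintro ⟨S, T⟩ _
      simp
  have h1 : ∑ S ∈ Fintype.piFinset t, ∑ T ∈ t i,
      (if bad (Function.update S i T) then (1 : ℝ) else 0)
      ≤ ∑ S ∈ Fintype.piFinset t, p * #(t i) :=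
    sum_le_sum fun S hS => by rw [sum_boole]; exact h S hS
  rw [hswap] at h1
  simp only [sum_const, nsmul_eq_mul] at h1
  rw [← mul_sum, sum_boole] at h1
  refine le_of_mul_le_mul_left ?_ hpos
  linarith

/-! ### Forward propagation -/

lemma partialProd_last {n : ℕ} (f : Fin n → ℝ) : Fin.partialProd f (Fin.last n) = ∏ i, f i := by
  simp [Fin.partialProd, List.take_of_length_le, List.prod_ofFn]

lemma partialProd_nonneg {n : ℕ} {f : Fin n → ℝ} (hf : ∀ i, 0 ≤ f i) (k : Fin (n + 1)) :
    0 ≤ Fin.partialProd f k := by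
  induction k using Fin.induction with
  | zero => simp
  | succ i ih => rw [Fin.partialProd_succ]; exact mul_nonneg ih (hf i)

lemma partialProd_pos {n : ℕ} {f : Fin n → ℝ} (hf : ∀ i, 0 < f i) (k : Fin (n + 1)) :
    0 < Fin.partialProd f k := by
  induction k using Fin.induction with
  | zero => simp
  | succ i ih => rw [Fin.partialProd_succ]; exact mul_pos ih (hf i)

/-- The product `∏_{i < k} m_i` of the sizes of the layers before layer `k`, which bounds the values
of the network at layer `k`. -/
noncomputable def layerProd {ℓ : ℕ} (m : Fin (ℓ + 2) → ℕ) (k : Fin (ℓ + 2)) : ℝ :=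
  Fin.partialProd (fun i : Fin (ℓ + 1) => (m i.castSucc : ℝ)) k

lemma layerProd_succ {ℓ : ℕ} (m : Fin (ℓ + 2) → ℕ) (i : Fin (ℓ + 1)) :
    layerProd m i.succ = layerProd m i.castSucc * m i.castSucc := by
  simp [layerProd, Fin.partialProd_succ]

lemma layerProd_last {ℓ : ℕ} (m : Fin (ℓ + 2) → ℕ) :
    layerProd m (Fin.last (ℓ + 1)) = ∏ i : Fin (ℓ + 1), (m i.castSucc : ℝ) :=
  partialProd_last _

lemma layerProd_pos {ℓ : ℕ} {m : Fin (ℓ + 2) → ℕ} (hm : ∀ k : Fin (ℓ + 1), 0 < m k.castSucc)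
    (k : Fin (ℓ + 2)) : 0 < layerProd m k :=
  partialProd_pos (fun i => by exact_mod_cast hm i) k

/-- The number of ones of an input. -/
def ones {ℓ : ℕ} {m : Fin (ℓ + 2) → ℕ} (x : Input m) : ℕ := #{t | x t = true}

section Propagation

variable {ℓ : ℕ} {m : Fin (ℓ + 2) → ℕ}

lemma layerValue_zero (W : Weights m) (x : Input m) : layerValue W x 0 = inputVector x := rfl

lemma layerValue_succ (W : Weights m) (x : Input m) (i : Fin (ℓ + 1)) (j : Fin (m i.succ)) :
    layerValue W x i.succ j = ∑ t, W i j t * max 0 (layerValue W x i.castSucc t) := rfl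

lemma sampledValue_zero (W : Weights m) (S : NodeSample m) (x : Input m) :
    sampledValue W S x 0 = inputVector x := rfl

lemma sampledValue_succ (W : Weights m) (S : NodeSample m) (x : Input m) (i : Fin (ℓ + 1))
    (j : Fin (m i.succ)) :
    sampledValue W S x i.succ j = ∑ t ∈ S i, W i j t * max 0 (sampledValue W S x i.castSucc t) := by
  rw [sampledValue, layerValue_succ, ← sum_subset (subset_univ (S i))]
  · refine sum_congr rfl fun t ht => ?_
    simp [samplingMatrix, Matrix.mul_diagonal, ht, sampledValue]
  · intro t _ ht
    simp [samplingMatrix, Matrix.mul_diagonal, ht]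

lemma usedNodes_castSucc (S : NodeSample m) (i : Fin (ℓ + 1)) : usedNodes S i.castSucc = S i := by
  simp [usedNodes]

lemma usedNodes_last (S : NodeSample m) : usedNodes S (Fin.last (ℓ + 1)) = univ := by
  simp [usedNodes]

lemma sum_inputVector (x : Input m) : ∑ t, max 0 (inputVector x t) = ones x := by
  rw [ones, card_filter]
  push_cast
  refine sum_congr rfl fun t _ => ?_
  by_cases h : x t <;> simp [inputVector, h]

lemma ones_le (x : Input m) : ones x ≤ m 0 := by
  simpa [ones] using card_filter_le (univ : Finset (Fin (m 0))) fun t => x t = true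

lemma abs_entry_le (N : ReLUNetwork m) (i j k) : |N.W i j k| ≤ 1 :=
  abs_le.2 (N.bounded i j k)

lemma abs_layerValue_succ_le (N : ReLUNetwork m) (x : Input m) (i : Fin (ℓ + 1))
    (j : Fin (m i.succ)) :
    |layerValue N.W x i.succ j| ≤ ∑ t, max 0 (layerValue N.W x i.castSucc t) := by
  rw [layerValue_succ]
  refine (abs_sum_le_sum_abs _ _).trans (sum_le_sum fun t _ => ?_)
  rw [abs_mul, abs_of_nonneg (le_max_left 0 (layerValue N.W x i.castSucc t))]
  exact mul_le_of_le_one_left (le_max_left _ _) (abs_entry_le N i j t)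

/-- By positive homogeneity, an input with few ones may be scaled up, as long as its total weight
stays at most `m_0`. -/
lemma mul_sum_relu_layerValue_le (N : ReLUNetwork m) (x : Input m) {c : ℝ} (hc : 0 ≤ c)
    (hx : c * ones x ≤ m 0) (k : Fin (ℓ + 2)) :
    c * ∑ t, max 0 (layerValue N.W x k t) ≤ layerProd m k * m k := by
  induction k using Fin.induction with
  | zero => rw [layerValue_zero, sum_inputVector]; simpa [layerProd] using hx
  | succ i ih =>
    have hnn : 0 ≤ ∑ t, max 0 (layerValue N.W x i.castSucc t) :=
      sum_nonneg fun t _ => le_max_left _ _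
    rw [layerProd_succ, mul_sum]
    calc ∑ j, c * max 0 (layerValue N.W x i.succ j)
        ≤ ∑ j : Fin (m i.succ), layerProd m i.castSucc * m i.castSucc := by
          refine sum_le_sum fun j _ => le_trans (mul_le_mul_of_nonneg_left ?_ hc) ih
          exact max_le hnn ((le_abs_self _).trans (abs_layerValue_succ_le N x i j))
      _ = _ := by simp [mul_comm]

lemma abs_mul_layerValue_succ_le (N : ReLUNetwork m) (x : Input m) {c : ℝ} (hc : 0 ≤ c)
    (hx : c * ones x ≤ m 0) (i : Fin (ℓ + 1)) (j : Fin (m i.succ)) :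
    |c * layerValue N.W x i.succ j| ≤ layerProd m i.succ := by
  rw [abs_mul, abs_of_nonneg hc, layerProd_succ]
  exact (mul_le_mul_of_nonneg_left (abs_layerValue_succ_le N x i j) hc).trans
    (mul_sum_relu_layerValue_le N x hc hx i.castSucc)

lemma abs_layerValue_le (N : ReLUNetwork m) (x : Input m) (k : Fin (ℓ + 2)) (j : Fin (m k)) :
    |layerValue N.W x k j| ≤ layerProd m k := by
  cases k using Fin.cases with
  | zero => by_cases h : x j <;> simp [layerValue_zero, inputVector, layerProd, h]
  | succ i =>
    simpa using abs_mul_layerValue_succ_le N x zero_le_one (by simpa using ones_le x) i j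

/-- The sampled sum at node `j` of layer `i + 1`, scaled by `m_i / s_i`, when `v` are the exact values
of layer `i`. -/
noncomputable def sampledSum (W : Weights m) (i : Fin (ℓ + 1)) (T : Finset (Fin (m i.castSucc)))
    (v : Fin (m i.castSucc) → ℝ) (j : Fin (m i.succ)) : ℝ :=
  (m i.castSucc : ℝ) / #T * ∑ t ∈ T, W i j t * max 0 (v t)

/-- If, in every layer, the sampled sums of the reference values `V` approximate the next reference
values at the sampled nodes, then the errors add up along the layers: ReLU is `1`-Lipschitz, and the
scaled sampled sums have operator norm at most `m_i`. -/
lemma abs_scaled_sampledValue_sub_le (N : ReLUNetwork m) (S : NodeSample m)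
    (hS : ∀ i, (S i).Nonempty) (x : Input m) (V : ∀ k, Fin (m k) → ℝ) (hV : V 0 = inputVector x)
    {η : ℝ}
    (hgood : ∀ i : Fin (ℓ + 1), ∀ j ∈ usedNodes S i.succ,
      |sampledSum N.W i (S i) (V i.castSucc) j - V i.succ j| ≤ η * layerProd m i.succ)
    (k : Fin (ℓ + 2)) :
    ∀ j ∈ usedNodes S k,
      |Fin.partialProd (fun i => (m i.castSucc : ℝ) / #(S i)) k * sampledValue N.W S x k j - V k j|
        ≤ k.val * (η * layerProd m k) := by
  induction k using Fin.induction with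
  | zero => intro j _; simp [sampledValue_zero, hV]
  | succ i ih =>
    intro j hj
    rw [usedNodes_castSucc] at ih
    set ρ := Fin.partialProd (fun i => (m i.castSucc : ℝ) / #(S i)) i.castSucc with hρ
    have hρ0 : 0 ≤ ρ := partialProd_nonneg (fun i => by positivity) _
    have hs : (0 : ℝ) < #(S i) := by exact_mod_cast (hS i).card_pos
    have h1 : Fin.partialProd (fun i => (m i.castSucc : ℝ) / #(S i)) i.succ
          * sampledValue N.W S x i.succ j
        = sampledSum N.W i (S i) (fun t => ρ * sampledValue N.W S x i.castSucc t) j := by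
      rw [Fin.partialProd_succ, sampledValue_succ, sampledSum, ← hρ, mul_comm ρ, mul_assoc, mul_sum]
      congr 1
      refine sum_congr rfl fun t _ => ?_
      have : max 0 (ρ * sampledValue N.W S x i.castSucc t)
          = ρ * max 0 (sampledValue N.W S x i.castSucc t) := by
        rw [mul_max_of_nonneg _ _ hρ0, mul_zero]
      rw [this]; ring
    have h2 : |sampledSum N.W i (S i) (fun t => ρ * sampledValue N.W S x i.castSucc t) j
          - sampledSum N.W i (S i) (V i.castSucc) j|
        ≤ i.val * (η * layerProd m i.succ) := by
      rw [sampledSum, sampledSum, ← mul_sub, ← sum_sub_distrib, abs_mul,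
        abs_of_nonneg (by positivity : (0 : ℝ) ≤ (m i.castSucc : ℝ) / #(S i))]
      have h3 : |∑ t ∈ S i, (N.W i j t * max 0 (ρ * sampledValue N.W S x i.castSucc t)
            - N.W i j t * max 0 (V i.castSucc t))|
          ≤ #(S i) * (i.val * (η * layerProd m i.castSucc)) := by
        rw [← nsmul_eq_mul, ← sum_const]
        refine (abs_sum_le_sum_abs _ _).trans (sum_le_sum fun t ht => ?_)
        rw [← mul_sub, abs_mul]
        have h4 : |max 0 (ρ * sampledValue N.W S x i.castSucc t) - max 0 (V i.castSucc t)|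
            ≤ |ρ * sampledValue N.W S x i.castSucc t - V i.castSucc t| := by
          have := abs_max_sub_max_le_abs (ρ * sampledValue N.W S x i.castSucc t)
            (V i.castSucc t) 0
          rwa [max_comm _ (0 : ℝ), max_comm _ (0 : ℝ)] at this
        exact (mul_le_of_le_one_left (abs_nonneg _) (abs_entry_le N i j t)).trans
          (h4.trans (ih t ht))
      refine (mul_le_mul_of_nonneg_left h3 (by positivity)).trans (le_of_eq ?_)
      rw [layerProd_succ]
      field_simp
    rw [h1]
    have h5 := hgood i j hj
    calc _ ≤ _ + _ := abs_sub_le _ (sampledSum N.W i (S i) (V i.castSucc) j) _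
      _ ≤ i.val * (η * layerProd m i.succ) + η * layerProd m i.succ := add_le_add h2 h5
      _ = _ := by rw [Fin.val_succ]; push_cast; ring

end Propagation

/-! ### Replacing a few nodes of every layer by a path of fixed sign -/

section Path

variable {ℓ : ℕ} {m : Fin (ℓ + 2) → ℕ}

/-- The weights in which the nodes outside `S` (the *path* nodes) are cut off from the other nodes
of the hidden layers. A path node sums up the path nodes of the preceding layer, or all inputs if it
belongs to layer `1`, and the last path nodes are subtracted from the output if `σ = 1`, and added to
it if `σ = -1`. -/
noncomputable def pathWeights (σ : ℝ) (W : Weights m) (S : NodeSample m) : Weights m :=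
  fun i j k =>
    if j ∈ usedNodes S i.succ then
      if k ∈ S i then W i j k else if i = Fin.last ℓ then -σ else 0
    else if i = 0 ∨ k ∉ S i then 1 else 0

/-- With `x` as input, a path node of layer `k` has the value `∏_{i < k} pathFactor S x i`. -/
noncomputable def pathFactor (S : NodeSample m) (x : Input m) (i : Fin (ℓ + 1)) : ℝ :=
  if i = 0 then ones x else #(S i)ᶜ

lemma pathFactor_nonneg (S : NodeSample m) (x : Input m) (i : Fin (ℓ + 1)) :
    0 ≤ pathFactor S x i := by
  unfold pathFactor; split_ifs <;> positivity

lemma layerValue_pathWeights (hℓ : 1 ≤ ℓ) (σ : ℝ) (W : Weights m) (S : NodeSample m)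
    (hS0 : S 0 = univ) (x : Input m) (k : Fin (ℓ + 2)) (j : Fin (m k)) :
    layerValue (pathWeights σ W S) x k j
      = if j ∈ usedNodes S k then
          sampledValue W S x k j
            - (if k = Fin.last (ℓ + 1) then σ * Fin.partialProd (pathFactor S x) k else 0)
        else Fin.partialProd (pathFactor S x) k := by
  induction k using Fin.induction with
  | zero =>
    have h0 : usedNodes S 0 = univ := (usedNodes_castSucc S 0).trans hS0
    have h1 : (0 : Fin (ℓ + 2)) ≠ Fin.last (ℓ + 1) := (Fin.last_pos).ne
    rw [h0]
    simp [h1, layerValue_zero, sampledValue_zero]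
  | succ i ih =>
    have hne : i.castSucc ≠ Fin.last (ℓ + 1) := i.castSucc_lt_last.ne
    have hp : 0 ≤ Fin.partialProd (pathFactor S x) i.castSucc :=
      partialProd_nonneg (pathFactor_nonneg S x) _
    simp only [usedNodes_castSucc, hne, if_false, sub_zero] at ih
    have hval : ∀ t, max 0 (layerValue (pathWeights σ W S) x i.castSucc t)
        = if t ∈ S i then max 0 (sampledValue W S x i.castSucc t)
          else Fin.partialProd (pathFactor S x) i.castSucc := by
      intro t
      rw [ih t]
      split_ifs
      · rfl
      · exact max_eq_right hp
    rw [layerValue_succ]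
    simp only [hval]
    by_cases hj : j ∈ usedNodes S i.succ
    · simp only [pathWeights, hj, if_true]
      rw [← sum_add_sum_compl (S i), sampledValue_succ]
      have e1 : ∀ t ∈ S i, (if t ∈ S i then W i j t else if i = Fin.last ℓ then -σ else 0)
          * (if t ∈ S i then max 0 (sampledValue W S x i.castSucc t)
            else Fin.partialProd (pathFactor S x) i.castSucc)
          = W i j t * max 0 (sampledValue W S x i.castSucc t) := by
        intro t ht; simp [ht]
      have e2 : ∀ t ∈ (S i)ᶜ, (if t ∈ S i then W i j t else if i = Fin.last ℓ then -σ else 0)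
          * (if t ∈ S i then max 0 (sampledValue W S x i.castSucc t)
            else Fin.partialProd (pathFactor S x) i.castSucc)
          = (if i = Fin.last ℓ then -σ else 0)
            * Fin.partialProd (pathFactor S x) i.castSucc := by
        intro t ht; simp [mem_compl.1 ht]
      rw [sum_congr rfl e1, sum_congr rfl e2, sub_eq_add_neg]
      congr 1
      rw [sum_const, nsmul_eq_mul]
      by_cases hi : i = Fin.last ℓ
      · have hi0 : i ≠ 0 := by
          rintro rfl
          have := congrArg Fin.val hi
          simp at this; omega
        have hi' : i.succ = Fin.last (ℓ + 1) := by rw [hi, Fin.succ_last]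
        rw [if_pos hi, if_pos hi', Fin.partialProd_succ, pathFactor, if_neg hi0]
        ring
      · have hi' : i.succ ≠ Fin.last (ℓ + 1) := by
          rw [← Fin.succ_last]; exact fun h => hi (Fin.succ_injective _ h)
        simp [hi, hi']
    · simp only [pathWeights, hj, if_false]
      rw [Fin.partialProd_succ]
      by_cases hi : i = 0
      · subst hi
        simp only [hS0, mem_univ, if_true, true_or, one_mul, pathFactor]
        have : Fin.partialProd (pathFactor S x) (Fin.castSucc 0) = 1 := by simp
        rw [this, one_mul]
        exact sum_inputVector x
      · rw [← sum_add_sum_compl (S i)]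
        have e1 : ∀ t ∈ S i, (if i = 0 ∨ t ∉ S i then (1 : ℝ) else 0)
            * (if t ∈ S i then max 0 (sampledValue W S x i.castSucc t)
              else Fin.partialProd (pathFactor S x) i.castSucc) = 0 := by
          intro t ht; simp [ht, hi]
        have e2 : ∀ t ∈ (S i)ᶜ, (if i = 0 ∨ t ∉ S i then (1 : ℝ) else 0)
            * (if t ∈ S i then max 0 (sampledValue W S x i.castSucc t)
              else Fin.partialProd (pathFactor S x) i.castSucc)
            = Fin.partialProd (pathFactor S x) i.castSucc := by
          intro t ht; simp [mem_compl.1 ht]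
        rw [sum_congr rfl e1, sum_congr rfl e2, pathFactor, if_neg hi]
        simp [mul_comm]

/-- The path network as a ReLU network. -/
noncomputable def pathNetwork (σ : ℝ) (hσ : |σ| ≤ 1) (N : ReLUNetwork m) (S : NodeSample m) :
    ReLUNetwork m where
  W := pathWeights σ N.W S
  bounded i j k := by
    have hσ' := abs_le.1 hσ
    unfold pathWeights
    split_ifs
    · exact N.bounded i j k
    · constructor <;> linarith [hσ'.1, hσ'.2]
    all_goals constructor <;> norm_num

/-- Only edges into or out of path nodes are changed. -/
lemma card_pathNetwork_ne_le (σ : ℝ) (hσ : |σ| ≤ 1) (N : ReLUNetwork m) (S : NodeSample m)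
    {ε : ℝ}
    (hS : ∀ k, (#(usedNodes S k)ᶜ : ℝ) ≤ ε / 2 * m k) (i : Fin (ℓ + 1)) :
    (#{p : Fin (m i.succ) × Fin (m i.castSucc) |
        (pathNetwork σ hσ N S).W i p.1 p.2 ≠ N.W i p.1 p.2} : ℝ)
      ≤ ε * m i.castSucc * m i.succ := by
  have hsub : ({p : Fin (m i.succ) × Fin (m i.castSucc) |
        (pathNetwork σ hσ N S).W i p.1 p.2 ≠ N.W i p.1 p.2} : Finset _)
      ⊆ (usedNodes S i.succ)ᶜ ×ˢ univ ∪ univ ×ˢ (usedNodes S i.castSucc)ᶜ := by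
    rintro ⟨j, k⟩ h
    simp only [mem_filter, mem_univ, true_and] at h
    simp only [mem_union, mem_product, mem_compl, mem_univ, and_true, true_and, usedNodes_castSucc]
    by_contra hc
    push Not at hc
    exact h (by simp [pathNetwork, pathWeights, hc.1, hc.2])
  have h1 := (card_le_card hsub).trans (card_union_le _ _)
  rw [card_product, card_product, card_univ, card_univ, Fintype.card_fin, Fintype.card_fin] at h1
  have h2 : (#{p : Fin (m i.succ) × Fin (m i.castSucc) |
        (pathNetwork σ hσ N S).W i p.1 p.2 ≠ N.W i p.1 p.2} : ℝ)
      ≤ #(usedNodes S i.succ)ᶜ * m i.castSucc + m i.succ * #(usedNodes S i.castSucc)ᶜ := by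
    exact_mod_cast h1
  refine h2.trans ?_
  have h3 := mul_le_mul_of_nonneg_right (hS i.succ) (Nat.cast_nonneg (α := ℝ) (m i.castSucc))
  have h4 := mul_le_mul_of_nonneg_left (hS i.castSucc) (Nat.cast_nonneg (α := ℝ) (m i.succ))
  linarith

end Path

/-! ### Concentration of the sampled sums -/

/-- Hoeffding's inequality for samples that leave out only few elements: the deviation of the sum
over a set is the negative of that of its complement, so what counts is the size of the latter. -/
lemma card_abs_sum_gt_le_of_compl {n s : ℕ} (v : Fin n → ℝ) {B t r : ℝ}
    (hv : ∀ i, |v i| ≤ B) (hs : s ≤ n) (hB : 0 < B) (ht : 0 ≤ t) (hr : 0 < r)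
    (hsr : (n : ℝ) - s ≤ r) :
    (#{S ∈ powersetCard s (univ : Finset (Fin n)) | t < |∑ i ∈ S, v i - s / n * ∑ i, v i|} : ℝ)
      ≤ 2 * Real.exp (-(t ^ 2 / (2 * r * B ^ 2))) * n.choose s := by
  have h := card_abs_sum_gt_le (univ : Finset (Fin n)) v (a := n - s) (fun i _ => hv i) (by simp)
    hB ht hr (by rw [Nat.cast_sub hs]; exact hsr)
  rw [card_univ, Fintype.card_fin, Nat.choose_symm hs] at h
  refine le_trans ?_ h
  norm_cast
  refine card_le_card_of_injOn (fun S => Sᶜ) ?_ (fun S _ S' _ h => compl_injective h)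
  intro S hS
  simp only [coe_filter, Set.mem_ofPred_eq, mem_powersetCard, subset_univ, true_and] at hS ⊢
  refine ⟨by rw [card_compl, hS.1, Fintype.card_fin], ?_⟩
  rw [← abs_neg]
  refine hS.2.trans_eq (congrArg _ ?_)
  rw [← sum_add_sum_compl S v, Nat.cast_sub hs]
  rcases Nat.eq_zero_or_pos n with h0 | h0
  · subst h0
    rw [eq_empty_of_isEmpty S, eq_empty_of_isEmpty (∅ᶜ : Finset (Fin 0))]
    simp
  · have : (n : ℝ) ≠ 0 := by positivity
    field_simp
    ring

/-- A sample whose sampled sum at node `j` of layer `i + 1` is off by more than `η m_i B` is one for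
which the unscaled sum deviates by more than `η s B` from its mean. -/
lemma abs_sum_sub_of_sampledSum {ℓ : ℕ} {m : Fin (ℓ + 2) → ℕ} (W : Weights m) (i : Fin (ℓ + 1))
    (T : Finset (Fin (m i.castSucc))) (v : Fin (m i.castSucc) → ℝ) (j : Fin (m i.succ))
    (hm : 0 < m i.castSucc) (hT : T.Nonempty) {η B : ℝ}
    (h : η * (B * m i.castSucc)
      < |sampledSum W i T v j - ∑ t, W i j t * max 0 (v t)|) :
    η * #T * B < |∑ t ∈ T, W i j t * max 0 (v t)
      - #T / m i.castSucc * ∑ t, W i j t * max 0 (v t)| := by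
  have hT0 : (0 : ℝ) < #T := by exact_mod_cast hT.card_pos
  have hm0 : (0 : ℝ) < m i.castSucc := by exact_mod_cast hm
  have e : sampledSum W i T v j - ∑ t, W i j t * max 0 (v t)
      = (m i.castSucc : ℝ) / #T * (∑ t ∈ T, W i j t * max 0 (v t)
      - #T / m i.castSucc * ∑ t, W i j t * max 0 (v t)) := by
    rw [sampledSum]
    field_simp
  rw [e, abs_mul, abs_of_pos (by positivity), div_mul_eq_mul_div, lt_div_iff₀ hT0] at h
  refine lt_of_mul_lt_mul_left ?_ hm0.le
  calc _ = η * (B * m i.castSucc) * #T := by ring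
    _ < _ := h

section Tail

variable {ℓ : ℕ} {m : Fin (ℓ + 2) → ℕ}

lemma abs_entry_mul_relu_le (N : ReLUNetwork m) (i : Fin (ℓ + 1)) (j : Fin (m i.succ))
    {v : Fin (m i.castSucc) → ℝ} {B : ℝ} (hv : ∀ t, |v t| ≤ B) (t : Fin (m i.castSucc)) :
    |N.W i j t * max 0 (v t)| ≤ B := by
  rw [abs_mul, abs_of_nonneg (le_max_left 0 (v t))]
  refine (mul_le_of_le_one_left (le_max_left _ _) (abs_entry_le N i j t)).trans ?_
  exact max_le ((abs_nonneg _).trans (hv t)) ((le_abs_self _).trans (hv t))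

open scoped Classical in
/-- The tail bound for a sampled sum; no error is made when the whole layer is taken. -/
lemma card_sampledSum_gt_le (N : ReLUNetwork m) (i : Fin (ℓ + 1)) {s : ℕ}
    (v : Fin (m i.castSucc) → ℝ) (j : Fin (m i.succ)) (hs0 : 0 < s) (hs : s ≤ m i.castSucc)
    {η B : ℝ} (hη : 0 ≤ η) (hB : 0 < B) (hv : ∀ t, |v t| ≤ B) :
    (#{T ∈ powersetCard s univ | η * (B * m i.castSucc)
        < |sampledSum N.W i T v j - ∑ t, N.W i j t * max 0 (v t)|} : ℝ)
      ≤ (if s < m i.castSucc then 2 * Real.exp (-(η ^ 2 * s / 2)) else 0)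
        * (m i.castSucc).choose s := by
  have hm : 0 < m i.castSucc := hs0.trans_le hs
  split_ifs with h
  · have hs0' : (0 : ℝ) < s := by exact_mod_cast hs0
    have ht := card_abs_sum_gt_le univ (fun t => N.W i j t * max 0 (v t)) (a := s) (r := s)
      (t := η * s * B) (fun t _ => abs_entry_mul_relu_le N i j hv t) (by simpa using hs) hB
      (by positivity) hs0' le_rfl
    have e : (η * s * B) ^ 2 / (2 * s * B ^ 2) = η ^ 2 * s / 2 := by field_simp
    rw [e, card_univ, Fintype.card_fin] at ht
    refine le_trans ?_ ht
    norm_cast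
    refine card_le_card fun T hT => ?_
    rw [mem_filter, mem_powersetCard] at hT ⊢
    refine ⟨hT.1, ?_⟩
    have := abs_sum_sub_of_sampledSum N.W i T v j hm (card_pos.1 (hT.1.2 ▸ hs0)) hT.2
    rwa [hT.1.2] at this
  · have hsm : s = m i.castSucc := le_antisymm hs (not_lt.1 h)
    rw [zero_mul]
    norm_cast
    rw [Nat.le_zero, card_eq_zero, filter_eq_empty_iff]
    intro T hT
    have hT' : T = univ := by
      rw [mem_powersetCard] at hT
      exact eq_univ_of_card T (by rw [hT.2, hsm, Fintype.card_fin])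
    have hm0 : (m i.castSucc : ℝ) ≠ 0 := by positivity
    rw [hT', sampledSum, card_univ, Fintype.card_fin, div_self hm0, one_mul, sub_self, abs_zero,
      not_lt]
    positivity

open scoped Classical in
lemma card_sampledSum_gt_le_of_compl (N : ReLUNetwork m) (i : Fin (ℓ + 1)) {s : ℕ}
    (v : Fin (m i.castSucc) → ℝ) (j : Fin (m i.succ)) (hs0 : 0 < s) (hs : s ≤ m i.castSucc)
    {η B r : ℝ} (hη : 0 ≤ η) (hB : 0 < B) (hv : ∀ t, |v t| ≤ B) (hr : 0 < r)
    (hsr : (m i.castSucc : ℝ) - s ≤ r) :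
    (#{T ∈ powersetCard s univ | η * (B * m i.castSucc)
        < |sampledSum N.W i T v j - ∑ t, N.W i j t * max 0 (v t)|} : ℝ)
      ≤ 2 * Real.exp (-(η ^ 2 * s ^ 2 / (2 * r))) * (m i.castSucc).choose s := by
  have hm : 0 < m i.castSucc := hs0.trans_le hs
  have ht := card_abs_sum_gt_le_of_compl (fun t => N.W i j t * max 0 (v t)) (s := s) (r := r)
    (t := η * s * B) (fun t => abs_entry_mul_relu_le N i j hv t) hs hB (by positivity) hr hsr
  have e : (η * s * B) ^ 2 / (2 * r * B ^ 2) = η ^ 2 * s ^ 2 / (2 * r) := by field_simp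
  rw [e] at ht
  refine le_trans ?_ ht
  norm_cast
  refine card_le_card fun T hT => ?_
  rw [mem_filter, mem_powersetCard] at hT ⊢
  refine ⟨hT.1, ?_⟩
  have := abs_sum_sub_of_sampledSum N.W i T v j hm (card_pos.1 (hT.1.2 ▸ hs0)) hT.2
  rwa [hT.1.2] at this

/-! ### Union bounds -/

lemma card_filter_exists_le {α β : Type*} (t : Finset α) (J : Finset β) (bad : β → α → Prop)
    [∀ b, DecidablePred (bad b)] [DecidablePred fun a => ∃ b ∈ J, bad b a] (q : ℝ) (h : ∀ b ∈ J, (#{a ∈ t | bad b a} : ℝ) ≤ q) :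
    (#{a ∈ t | ∃ b ∈ J, bad b a} : ℝ) ≤ #J * q := by
  classical
  have hsub : {a ∈ t | ∃ b ∈ J, bad b a} ⊆ J.biUnion fun b => {a ∈ t | bad b a} := by
    intro a ha
    simp only [mem_filter, mem_biUnion] at ha ⊢
    obtain ⟨h1, b, hb, h2⟩ := ha
    exact ⟨b, hb, h1, h2⟩
  have h1 : (#{a ∈ t | ∃ b ∈ J, bad b a} : ℝ) ≤ ∑ b ∈ J, (#{a ∈ t | bad b a} : ℝ) := by
    exact_mod_cast (card_le_card hsub).trans card_biUnion_le
  refine h1.trans ((sum_le_sum h).trans ?_)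
  simp

/-- All choices of `s_k` nodes in every layer `k`. -/
def nodeSamples (m : Fin (ℓ + 2) → ℕ) (s : Fin (ℓ + 1) → ℕ) : Finset (NodeSample m) :=
  Fintype.piFinset fun k => powersetCard (s k) univ

lemma card_of_mem_nodeSamples {s : Fin (ℓ + 1) → ℕ} {S : NodeSample m}
    (hS : S ∈ nodeSamples m s) (i : Fin (ℓ + 1)) : #(S i) = s i :=
  (mem_powersetCard.1 (Fintype.mem_piFinset.1 hS i)).2

lemma usedNodes_update_succ (S : NodeSample m) (i : Fin (ℓ + 1)) (T : Finset (Fin (m i.castSucc))) :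
    usedNodes (Function.update S i T) i.succ = usedNodes S i.succ := by
  have key : ∀ k : Fin (ℓ + 2), k ≠ i.castSucc →
      usedNodes (Function.update S i T) k = usedNodes S k := by
    intro k
    cases k using Fin.lastCases with
    | last => intro _; rw [usedNodes_last, usedNodes_last]
    | cast k =>
      intro hk
      rw [usedNodes_castSucc, usedNodes_castSucc, Function.update_of_ne]
      exact fun h => hk (by rw [h])
  exact key _ i.castSucc_lt_succ.ne'

/-- `S` is bad in layer `i` for the input `x`, scaled by `c`: at some sampled node of the next layer,
the sampled sum of the exact values differs from the exact sum by more than `η ∏_{k ≤ i} m_k`. -/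
def BadAt (N : ReLUNetwork m) (η c : ℝ) (x : Input m) (i : Fin (ℓ + 1)) (S : NodeSample m) : Prop :=
  ∃ j ∈ usedNodes S i.succ,
    η * layerProd m i.succ < |sampledSum N.W i (S i) (fun t => c * layerValue N.W x i.castSucc t) j
      - c * layerValue N.W x i.succ j|

open scoped Classical in
/-- The union bound over a set `X S` of inputs, which may depend on the sample in the other layers,
and over the sampled nodes of layer `i + 1`. As the layers are sampled independently, both sets may be
fixed before layer `i` is sampled. -/
lemma card_badAt_le (N : ReLUNetwork m) (s : Fin (ℓ + 1) → ℕ) {η c : ℝ} (hc : 0 ≤ c)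
    (i : Fin (ℓ + 1)) (X : NodeSample m → Finset (Input m))
    (hX : ∀ S T, X (Function.update S i T) = X S)
    (hXb : ∀ S ∈ nodeSamples m s, ∀ x ∈ X S, ∀ t,
      |c * layerValue N.W x i.castSucc t| ≤ layerProd m i.castSucc)
    {p M : ℝ} (hp : 0 ≤ p)
    (htail : ∀ (v : Fin (m i.castSucc) → ℝ) (j : Fin (m i.succ)),
      (∀ t, |v t| ≤ layerProd m i.castSucc) →
      (#{T ∈ powersetCard (s i) univ | η * (layerProd m i.castSucc * m i.castSucc)
          < |sampledSum N.W i T v j - ∑ t, N.W i j t * max 0 (v t)|} : ℝ)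
        ≤ p * (m i.castSucc).choose (s i))
    (hM : ∀ S ∈ nodeSamples m s, (#(X S) * #(usedNodes S i.succ) : ℝ) ≤ M) :
    (#{S ∈ nodeSamples m s | ∃ x ∈ X S, BadAt N η c x i S} : ℝ) ≤ M * p * #(nodeSamples m s) := by
  refine card_filter_piFinset_le _ i _ _ fun S hS => ?_
  have h := card_filter_exists_le (powersetCard (s i) (univ : Finset (Fin (m i.castSucc))))
    (X S ×ˢ usedNodes S i.succ) (fun q T => η * (layerProd m i.castSucc * m i.castSucc)
      < |sampledSum N.W i T (fun t => c * layerValue N.W q.1 i.castSucc t) q.2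
        - ∑ t, N.W i q.2 t * max 0 (c * layerValue N.W q.1 i.castSucc t)|)
    (p * (m i.castSucc).choose (s i)) (fun q hq => htail _ _ (hXb S hS q.1 (mem_product.1 hq).1))
  rw [card_product] at h
  push_cast at h
  have hle : #{T ∈ powersetCard (s i) (univ : Finset (Fin (m i.castSucc))) |
        ∃ x ∈ X (Function.update S i T), BadAt N η c x i (Function.update S i T)}
      ≤ #{T ∈ powersetCard (s i) (univ : Finset (Fin (m i.castSucc))) |
        ∃ q ∈ X S ×ˢ usedNodes S i.succ, η * (layerProd m i.castSucc * m i.castSucc)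
          < |sampledSum N.W i T (fun t => c * layerValue N.W q.1 i.castSucc t) q.2
            - ∑ t, N.W i q.2 t * max 0 (c * layerValue N.W q.1 i.castSucc t)|} := by
    refine card_le_card fun T hT => ?_
    rw [mem_filter] at hT ⊢
    obtain ⟨hT1, x, hx, j, hj, hlt⟩ := hT
    rw [hX] at hx
    rw [usedNodes_update_succ] at hj
    refine ⟨hT1, (x, j), mem_product.2 ⟨hx, hj⟩, ?_⟩
    have e : c * layerValue N.W x i.succ j
        = ∑ t, N.W i j t * max 0 (c * layerValue N.W x i.castSucc t) := by
      rw [layerValue_succ, mul_sum]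
      refine sum_congr rfl fun t _ => ?_
      have : max 0 (c * layerValue N.W x i.castSucc t)
          = c * max 0 (layerValue N.W x i.castSucc t) := by
        rw [mul_max_of_nonneg _ _ hc, mul_zero]
      rw [this]; ring
    rw [e, Function.update_self, layerProd_succ] at hlt
    exact hlt
  have hcard : (#(powersetCard (s i) (univ : Finset (Fin (m i.castSucc)))) : ℝ)
      = (m i.castSucc).choose (s i) := by
    rw [card_powersetCard, card_univ, Fintype.card_fin]
  rw [hcard]
  refine (Nat.cast_le.2 hle).trans (h.trans ?_)
  rw [mul_assoc M]
  exact mul_le_mul_of_nonneg_right (hM S hS) (by positivity)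

end Tail

section Estimates

variable {ℓ : ℕ} {m : Fin (ℓ + 2) → ℕ}

/-! ### The scaled output of the sampled network -/

/-- If no layer is bad, the scaled output of the sampled network is close to the exact output. The
sampled network may be run on another input `x` than the exact one, `x'`, and the latter may be
scaled by `c`, provided that the two agree approximately after the first layer. -/
lemma abs_scaledOutput_sub_le (N : ReLUNetwork m) (S : NodeSample m) (hS : ∀ i, (S i).Nonempty)
    (x x' : Input m) {c η : ℝ}
    (h0 : ∀ j ∈ usedNodes S (Fin.succ 0), |sampledSum N.W 0 (S 0) (inputVector x) j
      - c * layerValue N.W x' (Fin.succ 0) j| ≤ η * layerProd m (Fin.succ 0))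
    (hbad : ∀ i ≠ 0, ¬ BadAt N η c x' i S) (j : Fin (m (Fin.last (ℓ + 1)))) :
    |scaledOutput (fun i => #(S i)) N.W S x j - c * layerValue N.W x' (Fin.last (ℓ + 1)) j|
      ≤ ((ℓ : ℝ) + 1) * (η * ∏ i : Fin (ℓ + 1), (m i.castSucc : ℝ)) := by
  let V : ∀ k, Fin (m k) → ℝ :=
    Fin.cases (inputVector x) (fun i t => c * layerValue N.W x' i.succ t)
  have hV : ∀ k : Fin (ℓ + 2), k ≠ 0 → V k = fun t => c * layerValue N.W x' k t := by
    intro k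
    cases k using Fin.cases with
    | zero => intro h; exact absurd rfl h
    | succ i => intro _; rfl
  have hlast : Fin.last (ℓ + 1) ≠ 0 := (Fin.last_pos).ne'
  have h := abs_scaled_sampledValue_sub_le N S hS x V rfl (η := η) ?_ (Fin.last (ℓ + 1)) j
    (by simp [usedNodes_last])
  · rw [hV _ hlast, partialProd_last, layerProd_last, Fin.val_last] at h
    push_cast at h
    exact h
  · intro i j hj
    by_cases hi : i = 0
    · subst hi
      exact h0 j hj
    · have hi' : i.castSucc ≠ 0 := fun h => hi (Fin.castSucc_injective _ h)
      rw [hV _ hi']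
      by_contra hlt
      exact hbad i hi ⟨j, hj, not_le.1 hlt⟩

lemma abs_scaledOutput_sub_le_of_not_badAt (N : ReLUNetwork m) (S : NodeSample m)
    (hS : ∀ i, (S i).Nonempty) (x : Input m) {η : ℝ} (hbad : ∀ i, ¬ BadAt N η 1 x i S)
    (j : Fin (m (Fin.last (ℓ + 1)))) :
    |scaledOutput (fun i => #(S i)) N.W S x j - layerValue N.W x (Fin.last (ℓ + 1)) j|
      ≤ ((ℓ : ℝ) + 1) * (η * ∏ i : Fin (ℓ + 1), (m i.castSucc : ℝ)) := by
  have h := abs_scaledOutput_sub_le N S hS x x (c := 1) (η := η) ?_ (fun i _ => hbad i) j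
  · simpa using h
  · intro j hj
    by_contra hlt
    refine hbad 0 ⟨j, hj, ?_⟩
    simpa [layerValue_zero] using not_le.1 hlt

/-- The input that agrees with `x` on `T` and is `0` elsewhere. -/
def restrictInput (T : Finset (Fin (m 0))) (x : Input m) : Input m := fun t => decide (t ∈ T) && x t

/-- The inputs that vanish outside `T`. -/
noncomputable def inputsOn (T : Finset (Fin (m 0))) : Finset (Input m) :=
  T.powerset.image fun y t => decide (t ∈ y)

lemma card_inputsOn_le (T : Finset (Fin (m 0))) : #(inputsOn T : Finset (Input m)) ≤ 2 ^ #T :=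
  card_image_le.trans_eq (card_powerset T)

lemma restrictInput_mem (T : Finset (Fin (m 0))) (x : Input m) :
    restrictInput T x ∈ (inputsOn T : Finset (Input m)) := by
  refine mem_image.2 ⟨T.filter fun t => x t = true, by simp, ?_⟩
  funext t
  simp [restrictInput]

lemma ones_le_of_mem_inputsOn {T : Finset (Fin (m 0))} {x : Input m} (hx : x ∈ inputsOn T) :
    ones x ≤ #T := by
  obtain ⟨y, hy, rfl⟩ := mem_image.1 hx
  refine card_le_card fun t ht => mem_powerset.1 hy ?_
  simpa using ht

/-- If only the inputs in `T` are sampled, then the sampled network on `x` behaves, up to the scaling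
factor `m_0 / s_0`, like the network on the restriction of `x` to `T`: the first layer is exact. -/
lemma sampledSum_inputVector (N : ReLUNetwork m) (T : Finset (Fin (m 0))) (x : Input m)
    (j : Fin (m (Fin.succ 0))) :
    sampledSum N.W 0 T (inputVector x) j
      = (m 0 : ℝ) / #T * layerValue N.W (restrictInput T x) (Fin.succ 0) j := by
  change (m 0 : ℝ) / #T * ∑ t ∈ T, N.W 0 j t * max 0 (inputVector x t)
    = (m 0 : ℝ) / #T * ∑ t : Fin (m 0), N.W 0 j t * max 0 (inputVector (restrictInput T x) t)
  congr 1
  refine sum_subset_zero_on_sdiff (subset_univ T) (fun t ht => ?_) (fun t ht => ?_)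
  · simp [inputVector, restrictInput, (mem_sdiff.1 ht).2]
  · simp [inputVector, restrictInput, ht]

lemma card_usedNodes_succ_le {s : Fin (ℓ + 1) → ℕ} {S : NodeSample m} (hS : S ∈ nodeSamples m s)
    (hlast : m (Fin.last (ℓ + 1)) = 1) {M : ℝ} (hM1 : 1 ≤ M) (hM : ∀ i ≠ 0, (s i : ℝ) ≤ M)
    (i : Fin (ℓ + 1)) : (#(usedNodes S i.succ) : ℝ) ≤ M := by
  have key : ∀ k : Fin (ℓ + 2), k ≠ 0 → (#(usedNodes S k) : ℝ) ≤ M := by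
    intro k
    cases k using Fin.lastCases with
    | last => intro _; simpa [usedNodes_last, hlast] using hM1
    | cast k =>
      intro hk
      rw [usedNodes_castSucc, card_of_mem_nodeSamples hS]
      exact hM k fun h => hk (by rw [h]; rfl)
  exact key _ (Fin.succ_ne_zero i)

open scoped Classical in
/-- For every input at once, the sampled network approximates the network restricted to the sampled
inputs. There are only `2 ^ s_0` inputs to take care of. -/
lemma card_exists_scaledOutput_restrict_le (N : ReLUNetwork m) (s : Fin (ℓ + 1) → ℕ)
    (hs0 : ∀ k, 0 < s k) (hs : ∀ k, s k ≤ m k.castSucc) (hlast : m (Fin.last (ℓ + 1)) = 1)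
    {η M lam : ℝ} (hη : 0 ≤ η) (hlam : 0 ≤ lam) (hM1 : 1 ≤ M) (hM : ∀ i ≠ 0, (s i : ℝ) ≤ M)
    (hnum : ∀ i ≠ 0, s i < m i.castSucc →
      2 ^ s 0 * M * (2 * Real.exp (-(η ^ 2 * s i / 2))) ≤ lam / ((ℓ : ℝ) + 1)) :
    (#{S ∈ nodeSamples m s | ∃ x j,
        ((ℓ : ℝ) + 1) * (η * ∏ i : Fin (ℓ + 1), (m i.castSucc : ℝ))
          < |scaledOutput s N.W S x j - (m 0 : ℝ) / s 0
              * layerValue N.W (restrictInput (S 0) x) (Fin.last (ℓ + 1)) j|} : ℝ)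
      ≤ lam * #(nodeSamples m s) := by
  have hm : ∀ k : Fin (ℓ + 1), 0 < m k.castSucc := fun k => (hs0 k).trans_le (hs k)
  have hs00 : (0 : ℝ) < s 0 := by exact_mod_cast hs0 0
  have hℓ0 : (0 : ℝ) < (ℓ : ℝ) + 1 := by positivity
  have hc : (0 : ℝ) ≤ (m 0 : ℝ) / s 0 := by positivity
  have hbad : ∀ i ∈ univ.filter (fun i : Fin (ℓ + 1) => i ≠ 0),
      (#{S ∈ nodeSamples m s | ∃ x ∈ inputsOn (S 0), BadAt N η ((m 0 : ℝ) / s 0) x i S} : ℝ)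
        ≤ lam / ((ℓ : ℝ) + 1) * #(nodeSamples m s) := by
    intro i hi
    have hi0 : i ≠ 0 := (mem_filter.1 hi).2
    have h := card_badAt_le N s hc i (η := η) (fun S => inputsOn (S 0))
      (fun S T => by rw [Function.update_of_ne hi0.symm])
      ?_ (p := if s i < m i.castSucc then 2 * Real.exp (-(η ^ 2 * s i / 2)) else 0)
      (M := 2 ^ s 0 * M) (by split_ifs <;> positivity)
      (fun v j hv => card_sampledSum_gt_le N i v j (hs0 i) (hs i) hη (layerProd_pos hm _) hv) ?_
    · refine h.trans (mul_le_mul_of_nonneg_right ?_ (by positivity))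
      split_ifs with hlt
      · exact hnum i hi0 hlt
      · rw [mul_zero]; positivity
    · intro S hS x hx t
      have hones : (m 0 : ℝ) / s 0 * ones x ≤ m 0 := by
        have h1 : (ones x : ℝ) ≤ s 0 := by
          rw [← card_of_mem_nodeSamples hS 0]
          exact_mod_cast ones_le_of_mem_inputsOn hx
        rw [div_mul_eq_mul_div, div_le_iff₀ hs00]
        exact mul_le_mul_of_nonneg_left h1 (by positivity)
      have key : ∀ k : Fin (ℓ + 2), k ≠ 0 → ∀ t, |(m 0 : ℝ) / s 0 * layerValue N.W x k t|
          ≤ layerProd m k := by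
        intro k
        cases k using Fin.cases with
        | zero => intro h; exact absurd rfl h
        | succ k => intro _ t; exact abs_mul_layerValue_succ_le N x hc hones k t
      exact key _ (fun h => hi0 (Fin.castSucc_injective _ h)) t
    · intro S hS
      refine mul_le_mul ?_ (card_usedNodes_succ_le hS hlast hM1 hM i) (by positivity)
        (by positivity)
      rw [← card_of_mem_nodeSamples hS 0]
      exact_mod_cast card_inputsOn_le (S 0)
  have hun := card_filter_exists_le (nodeSamples m s) _ _ _ hbad
  have hle : (#(univ.filter (fun i : Fin (ℓ + 1) => i ≠ 0)) : ℝ) ≤ (ℓ : ℝ) + 1 := by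
    have := card_filter_le (univ : Finset (Fin (ℓ + 1))) (fun i => i ≠ 0)
    rw [card_univ, Fintype.card_fin] at this
    exact_mod_cast this
  calc _ ≤ (#{S ∈ nodeSamples m s | ∃ i ∈ univ.filter (fun i : Fin (ℓ + 1) => i ≠ 0),
            ∃ x ∈ inputsOn (S 0), BadAt N η ((m 0 : ℝ) / s 0) x i S} : ℝ) := by
        refine Nat.cast_le.2 (card_le_card fun S hS => ?_)
        rw [mem_filter] at hS ⊢
        obtain ⟨hS1, x, j, hlt⟩ := hS
        refine ⟨hS1, ?_⟩
        by_contra hno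
        refine absurd hlt (not_lt.2 ?_)
        have hcard := fun i => card_of_mem_nodeSamples hS1 i
        have := abs_scaledOutput_sub_le N S
          (fun i => card_pos.1 (by rw [hcard]; exact hs0 i)) x (restrictInput (S 0) x)
          (c := (m 0 : ℝ) / s 0) (η := η) ?_ ?_ j
        · simpa [hcard] using this
        · intro j _
          have h1 := sampledSum_inputVector N (S 0) x j
          have hc0 : card (α := Fin (m 0)) (S 0) = s 0 := hcard 0
          rw [hc0] at h1
          refine (congrArg abs (sub_eq_zero.2 h1)).trans_le ?_
          rw [abs_zero]
          exact mul_nonneg hη (layerProd_pos hm _).le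
        · intro i hi hb
          exact hno ⟨i, by simpa using hi, _, restrictInput_mem _ x, hb⟩
    _ ≤ #(univ.filter (fun i : Fin (ℓ + 1) => i ≠ 0))
          * (lam / ((ℓ : ℝ) + 1) * #(nodeSamples m s)) := hun
    _ ≤ ((ℓ : ℝ) + 1) * (lam / ((ℓ : ℝ) + 1) * #(nodeSamples m s)) :=
        mul_le_mul_of_nonneg_right hle (by positivity)
    _ = lam * #(nodeSamples m s) := by field_simp

open scoped Classical in
/-- For a fixed input, the scaled output is inaccurate only if some layer is bad, so a bound on the
probability that a given layer is bad suffices. -/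
lemma card_exists_scaledOutput_le (N : ReLUNetwork m) (s : Fin (ℓ + 1) → ℕ)
    (hs0 : ∀ k, 0 < s k) (x : Input m) {η lam : ℝ}
    (hbad : ∀ i, (#{S ∈ nodeSamples m s | BadAt N η 1 x i S} : ℝ)
        ≤ lam / ((ℓ : ℝ) + 1) * #(nodeSamples m s)) :
    (#{S ∈ nodeSamples m s | ∃ j,
        ((ℓ : ℝ) + 1) * (η * ∏ i : Fin (ℓ + 1), (m i.castSucc : ℝ))
          < |scaledOutput s N.W S x j - layerValue N.W x (Fin.last (ℓ + 1)) j|} : ℝ)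
      ≤ lam * #(nodeSamples m s) := by
  have hℓ0 : (0 : ℝ) < (ℓ : ℝ) + 1 := by positivity
  have hun := card_filter_exists_le (nodeSamples m s) univ _ _ fun i _ => hbad i
  rw [card_univ, Fintype.card_fin] at hun
  calc _ ≤ (#{S ∈ nodeSamples m s | ∃ i ∈ univ, BadAt N η 1 x i S} : ℝ) := by
        refine Nat.cast_le.2 (card_le_card fun S hS => ?_)
        rw [mem_filter] at hS ⊢
        obtain ⟨hS1, j, hlt⟩ := hS
        refine ⟨hS1, ?_⟩
        by_contra hno
        refine absurd hlt (not_lt.2 ?_)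
        have hcard := fun i => card_of_mem_nodeSamples hS1 i
        have := abs_scaledOutput_sub_le_of_not_badAt N S
          (fun i => card_pos.1 (by rw [hcard]; exact hs0 i)) x (η := η)
          (fun i hb => hno ⟨i, mem_univ _, hb⟩) j
        simpa [hcard] using this
    _ ≤ ((ℓ + 1 : ℕ) : ℝ) * (lam / ((ℓ : ℝ) + 1) * #(nodeSamples m s)) := hun
    _ = lam * #(nodeSamples m s) := by push_cast; field_simp

open scoped Classical in
/-- The probability that a single layer is bad for a fixed input, from a tail bound for the sampled
sums. -/
lemma card_badAt_one_le (N : ReLUNetwork m) (s : Fin (ℓ + 1) → ℕ) (x : Input m) {η p M : ℝ}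
    (i : Fin (ℓ + 1)) (hp : 0 ≤ p)
    (htail : ∀ (v : Fin (m i.castSucc) → ℝ) (j : Fin (m i.succ)),
      (∀ t, |v t| ≤ layerProd m i.castSucc) →
      (#{T ∈ powersetCard (s i) univ | η * (layerProd m i.castSucc * m i.castSucc)
          < |sampledSum N.W i T v j - ∑ t, N.W i j t * max 0 (v t)|} : ℝ)
        ≤ p * (m i.castSucc).choose (s i))
    (hM : ∀ S ∈ nodeSamples m s, (#(usedNodes S i.succ) : ℝ) ≤ M) :
    (#{S ∈ nodeSamples m s | BadAt N η 1 x i S} : ℝ) ≤ M * p * #(nodeSamples m s) := by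
  have h := card_badAt_le N s zero_le_one i (η := η) (fun _ => {x}) (fun _ _ => rfl)
    (fun S _ y hy t => by
      rw [mem_singleton.1 hy, one_mul]; exact abs_layerValue_le N x _ t) hp htail
    (M := M) (fun S hS => by simpa using hM S hS)
  simpa using h

end Estimates

/-! ### Closeness of networks with small values -/

section Close

variable {ℓ : ℕ} {m : Fin (ℓ + 2) → ℕ}

/-- Few inputs have less than `3/10` of their bits equal to `1`. -/
lemma card_ones_le_le (m : Fin (ℓ + 2) → ℕ) :
    (#{x : Input m | (ones x : ℝ) ≤ 3 / 10 * m 0} : ℝ)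
      ≤ Real.exp (-(m 0 : ℝ) / 16) * 2 ^ m 0 := by
  -- Chernoff's method with exponent `θ = 4/5`
  set g : Bool → ℝ := fun b => if b then Real.exp (-(4 / 5)) else 1 with hg
  have hprod : ∀ x : Input m, ∏ t, g (x t) = Real.exp (-(4 / 5) * ones x) := by
    intro x
    rw [ones, mul_comm, Real.exp_nat_mul, ← prod_const, prod_filter]
  have hsum : ∑ x : Input m, Real.exp (-(4 / 5) * ones x) = (1 + Real.exp (-(4 / 5))) ^ m 0 := by
    rw [← sum_congr rfl fun x _ => hprod x]
    have h := Fintype.sum_pow g (m 0)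
    rw [← h]
    simp [hg, add_comm]
  have hmgf : 1 + Real.exp (-(4 / 5)) ≤ 2 * Real.exp (-(8 / 25)) := by
    have h := Real.cosh_le_exp_half_sq (2 / 5)
    rw [Real.cosh_eq] at h
    have e1 : 1 + Real.exp (-(4 / 5))
        = 2 * (Real.exp (-(2 / 5)) * ((Real.exp (2 / 5) + Real.exp (-(2 / 5))) / 2)) := by
      rw [mul_div_assoc', mul_add, ← Real.exp_add, ← Real.exp_add]
      norm_num
      ring
    have e2 : Real.exp (-(8 / 25)) = Real.exp (-(2 / 5)) * Real.exp ((2 / 5) ^ 2 / 2) := by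
      rw [← Real.exp_add]; norm_num
    rw [e1, e2]
    gcongr
  have hmarkov : (#{x : Input m | (ones x : ℝ) ≤ 3 / 10 * m 0} : ℝ)
      * Real.exp (-(4 / 5) * (3 / 10 * m 0)) ≤ ∑ x : Input m, Real.exp (-(4 / 5) * ones x) := by
    rw [← nsmul_eq_mul, ← sum_const]
    refine (sum_le_sum fun x hx => ?_).trans
      (sum_le_sum_of_subset_of_nonneg (filter_subset _ _) fun S _ _ => (Real.exp_pos _).le)
    refine Real.exp_le_exp.2 ?_
    have := (mem_filter.1 hx).2
    linarith
  have hpow : (1 + Real.exp (-(4 / 5))) ^ m 0 ≤ 2 ^ m 0 * Real.exp (m 0 * (-(8 / 25))) := by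
    rw [Real.exp_nat_mul, ← mul_pow]
    gcongr
  rw [hsum] at hmarkov
  have h1 := hmarkov.trans hpow
  rw [← le_div_iff₀ (Real.exp_pos _), mul_div_assoc, ← Real.exp_sub] at h1
  refine h1.trans ?_
  rw [mul_comm]
  gcongr
  have : (0 : ℝ) ≤ m 0 := by positivity
  linarith

/-- The lower bound on the size of layer `i` that makes deleting a few of its nodes harmless. -/
def LayerLarge (m : Fin (ℓ + 2) → ℕ) (ε lamStar : ℝ) (i : Fin (ℓ + 1)) : Prop :=
  171 * ((ℓ : ℝ) + 1) ^ 2 * (2 / ε) ^ (2 * ℓ) *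
    Real.log (1 / lamStar * ∏ k ∈ Finset.Ioi i, (m k.castSucc : ℝ)) ≤ (m i.castSucc : ℝ)

lemma succ_le_prod_Ioi (hm : ∀ k : Fin (ℓ + 1), 0 < m k.castSucc)
    (hlast : m (Fin.last (ℓ + 1)) = 1) (i : Fin (ℓ + 1)) :
    m i.succ ≤ ∏ k ∈ Finset.Ioi i, m k.castSucc := by
  have hpos : 0 < ∏ k ∈ Finset.Ioi i, m k.castSucc := prod_pos fun k _ => hm k
  have key : ∀ k : Fin (ℓ + 2), i.castSucc < k → m k ≤ ∏ k ∈ Finset.Ioi i, m k.castSucc := by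
    intro k
    cases k using Fin.lastCases with
    | last => intro _; rw [hlast]; exact hpos
    | cast k =>
      intro hk
      exact Nat.le_of_dvd hpos (dvd_prod_of_mem (fun k : Fin (ℓ + 1) => m k.castSucc)
        (mem_Ioi.2 (Fin.castSucc_lt_castSucc_iff.1 hk)))
  exact key _ i.castSucc_lt_succ

lemma one_div_le_mul_prod_Ioi (hm : ∀ k : Fin (ℓ + 1), 0 < m k.castSucc) {lamStar : ℝ}
    (hlam0 : 0 < lamStar) (i : Fin (ℓ + 1)) :
    1 / lamStar ≤ 1 / lamStar * ∏ k ∈ Finset.Ioi i, (m k.castSucc : ℝ) := by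
  refine le_mul_of_one_le_right (by positivity) ?_
  exact_mod_cast Nat.one_le_iff_ne_zero.2 (prod_pos fun k (_ : k ∈ Finset.Ioi i) => hm k).ne'

/-- The number of deleted nodes in layer `i` loses little by rounding. -/
lemma ten_mul_le_of_layerLarge (hℓ : 1 ≤ ℓ) (hm : ∀ k : Fin (ℓ + 1), 0 < m k.castSucc)
    {ε lamStar : ℝ} (hε0 : 0 < ε) (hε : ε < 1 / 2)
    (hlam0 : 0 < lamStar) (hlam : lamStar < 1 / ((ℓ : ℝ) + 1)) {i : Fin (ℓ + 1)}
    (hlarge : LayerLarge m ε lamStar i) : 10 * ((ℓ : ℝ) + 1) ≤ ε / 2 * m i.castSucc := by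
  have hℓ1 : (1 : ℝ) ≤ ℓ := by exact_mod_cast hℓ
  have hX := one_div_le_mul_prod_Ioi hm hlam0 i
  have hlamX : (2 : ℝ) ≤ 1 / lamStar := by
    rw [lt_div_iff₀ (by positivity)] at hlam
    rw [le_div_iff₀ hlam0]
    nlinarith
  have hlog : (69 / 100 : ℝ)
      ≤ Real.log (1 / lamStar * ∏ k ∈ Finset.Ioi i, (m k.castSucc : ℝ)) :=
    le_trans (by linarith [Real.log_two_gt_d9])
      (Real.log_le_log (by norm_num) (hlamX.trans hX))
  have h1 : (1 : ℝ) ≤ 2 / ε := by rw [le_div_iff₀ hε0]; linarith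
  have hpow : 2 / ε ≤ (2 / ε) ^ (2 * ℓ) := le_self_pow₀ h1 (by omega)
  have h2 : 171 * ((ℓ : ℝ) + 1) ^ 2 * (2 / ε) * (69 / 100) ≤ (m i.castSucc : ℝ) :=
    le_trans (by gcongr) hlarge
  have h3 : ε / 2 * (171 * ((ℓ : ℝ) + 1) ^ 2 * (2 / ε) * (69 / 100))
      ≤ ε / 2 * (m i.castSucc : ℝ) := mul_le_mul_of_nonneg_left h2 (by positivity)
  refine le_trans ?_ h3
  have e : ε / 2 * (171 * ((ℓ : ℝ) + 1) ^ 2 * (2 / ε) * (69 / 100))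
      = 171 * (69 / 100) * ((ℓ : ℝ) + 1) ^ 2 := by field_simp
  rw [e]
  nlinarith

/-- The failure probability of layer `i`, including the union bound over the next layer. With
`X = λ*⁻¹ ∏_{k > i} m_k` the tail is at most `2 X⁻³`, and `m_{i+1} ≤ λ* X`. -/
lemma tail_le_of_layerLarge (hℓ : 1 ≤ ℓ) (hm : ∀ k : Fin (ℓ + 1), 0 < m k.castSucc)
    (hlast : m (Fin.last (ℓ + 1)) = 1)
    {ε lamStar : ℝ} (hε0 : 0 < ε)
    (hlam0 : 0 < lamStar) (hlam : lamStar < 1 / ((ℓ : ℝ) + 1)) {i : Fin (ℓ + 1)}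
    (hlarge : LayerLarge m ε lamStar i) {s : ℕ} (hs : 3 / 4 * (m i.castSucc : ℝ) ≤ s) :
    (m i.succ : ℝ) * (2 * Real.exp (-(((ε / 2) ^ ℓ / (8 * ((ℓ : ℝ) + 1))) ^ 2 * (s : ℝ) ^ 2
      / (2 * ((m i.castSucc : ℝ) / 4))))) ≤ lamStar / ((ℓ : ℝ) + 1) := by
  have hℓ1 : (1 : ℝ) ≤ ℓ := by exact_mod_cast hℓ
  have hm0 : (0 : ℝ) < m i.castSucc := by exact_mod_cast hm i
  have hX := one_div_le_mul_prod_Ioi hm hlam0 i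
  have hmX : (m i.succ : ℝ) ≤ ∏ k ∈ Finset.Ioi i, (m k.castSucc : ℝ) := by
    exact_mod_cast succ_le_prod_Ioi hm hlast i
  unfold LayerLarge at hlarge
  set Q : ℝ := ∏ k ∈ Finset.Ioi i, (m k.castSucc : ℝ) with hQ
  set X : ℝ := 1 / lamStar * Q with hXdef
  have hlamX : (ℓ : ℝ) + 1 ≤ 1 / lamStar := by
    rw [lt_div_iff₀ (by positivity)] at hlam
    rw [le_div_iff₀ hlam0]
    nlinarith
  have hX1 : 1 ≤ X := by linarith
  have hX0 : 0 < X := by linarith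
  have hlog : 0 ≤ Real.log X := Real.log_nonneg hX1
  have hexp : 3 * Real.log X ≤ ((ε / 2) ^ ℓ / (8 * ((ℓ : ℝ) + 1))) ^ 2 * (s : ℝ) ^ 2
      / (2 * ((m i.castSucc : ℝ) / 4)) := by
    have hs2 : (3 / 4 * (m i.castSucc : ℝ)) ^ 2 ≤ (s : ℝ) ^ 2 := by gcongr
    have h1 : ((ε / 2) ^ ℓ / (8 * ((ℓ : ℝ) + 1))) ^ 2 * (3 / 4 * (m i.castSucc : ℝ)) ^ 2
        / (2 * ((m i.castSucc : ℝ) / 4)) ≤ ((ε / 2) ^ ℓ / (8 * ((ℓ : ℝ) + 1))) ^ 2 * (s : ℝ) ^ 2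
        / (2 * ((m i.castSucc : ℝ) / 4)) := by gcongr
    refine le_trans ?_ h1
    have e : ((ε / 2) ^ ℓ / (8 * ((ℓ : ℝ) + 1))) ^ 2 * (3 / 4 * (m i.castSucc : ℝ)) ^ 2
        / (2 * ((m i.castSucc : ℝ) / 4))
        = (9 / 512) * (((ε / 2) ^ (2 * ℓ)) / ((ℓ : ℝ) + 1) ^ 2) * m i.castSucc := by
      rw [pow_mul' (ε / 2) 2 ℓ]
      field_simp
      ring
    rw [e]
    have h2 : (9 / 512) * (((ε / 2) ^ (2 * ℓ)) / ((ℓ : ℝ) + 1) ^ 2)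
        * (171 * ((ℓ : ℝ) + 1) ^ 2 * (2 / ε) ^ (2 * ℓ) * Real.log X)
        ≤ (9 / 512) * (((ε / 2) ^ (2 * ℓ)) / ((ℓ : ℝ) + 1) ^ 2) * m i.castSucc :=
      mul_le_mul_of_nonneg_left hlarge (by positivity)
    refine le_trans ?_ h2
    have e2 : (ε / 2) ^ (2 * ℓ) * (2 / ε) ^ (2 * ℓ) = 1 := by
      rw [← mul_pow, show ε / 2 * (2 / ε) = 1 by field_simp, one_pow]
    have e3 : (9 / 512) * (((ε / 2) ^ (2 * ℓ)) / ((ℓ : ℝ) + 1) ^ 2)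
        * (171 * ((ℓ : ℝ) + 1) ^ 2 * (2 / ε) ^ (2 * ℓ) * Real.log X)
        = 9 / 512 * 171 * ((ε / 2) ^ (2 * ℓ) * (2 / ε) ^ (2 * ℓ)) * Real.log X := by
      field_simp
    rw [e3, e2]
    nlinarith
  have hexp3 : Real.exp (-(3 * Real.log X)) = 1 / X ^ 3 := by
    rw [Real.exp_neg, show 3 * Real.log X = ((3 : ℕ) : ℝ) * Real.log X by norm_num,
      Real.exp_nat_mul, Real.exp_log hX0, one_div]
  have hmX' : (m i.succ : ℝ) ≤ lamStar * X := by
    rw [hXdef]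
    refine hmX.trans (le_of_eq ?_)
    field_simp
  have hXℓ : (ℓ : ℝ) + 1 ≤ X := hlamX.trans hX
  calc (m i.succ : ℝ) * (2 * Real.exp (-(((ε / 2) ^ ℓ / (8 * ((ℓ : ℝ) + 1))) ^ 2 * (s : ℝ) ^ 2
      / (2 * ((m i.castSucc : ℝ) / 4)))))
      ≤ lamStar * X * (2 * (1 / X ^ 3)) := by
        rw [← hexp3]
        gcongr
    _ = lamStar * (2 / X * (1 / X)) := by field_simp
    _ ≤ lamStar * (1 * (1 / ((ℓ : ℝ) + 1))) := by
        gcongr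
        rw [div_le_one hX0]
        linarith
    _ = lamStar / ((ℓ : ℝ) + 1) := by ring

/-- The number of nodes kept in layer `i` when a fraction `ε / 2` of the nodes of every hidden layer
is deleted, rounded down. -/
noncomputable def keptSize (m : Fin (ℓ + 2) → ℕ) (ε : ℝ) (i : Fin (ℓ + 1)) : ℕ :=
  if i = 0 then m i.castSucc else m i.castSucc - ⌊ε / 2 * m i.castSucc⌋₊

lemma keptSize_le (m : Fin (ℓ + 2) → ℕ) (ε : ℝ) (i : Fin (ℓ + 1)) :
    keptSize m ε i ≤ m i.castSucc := by
  unfold keptSize; split_ifs <;> omega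

lemma floor_le_of_lt_half {ε : ℝ} (hε0 : 0 < ε) (hε : ε < 1 / 2) (n : ℕ) :
    (⌊ε / 2 * n⌋₊ : ℝ) ≤ n / 4 := by
  refine (Nat.floor_le (by positivity)).trans ?_
  have : (0 : ℝ) ≤ n := by positivity
  nlinarith

lemma le_keptSize {ε : ℝ} (hε0 : 0 < ε) (hε : ε < 1 / 2) (i : Fin (ℓ + 1)) :
    3 / 4 * (m i.castSucc : ℝ) ≤ keptSize m ε i := by
  have hn : (0 : ℝ) ≤ m i.castSucc := by positivity
  unfold keptSize
  split_ifs
  · linarith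
  · have h := floor_le_of_lt_half hε0 hε (m i.castSucc)
    have h' : ⌊ε / 2 * (m i.castSucc : ℝ)⌋₊ ≤ m i.castSucc := by
      have : (⌊ε / 2 * (m i.castSucc : ℝ)⌋₊ : ℝ) ≤ m i.castSucc := by linarith
      exact_mod_cast this
    rw [Nat.cast_sub h']
    linarith

open scoped Classical in
/-- For every fixed input, deleting random nodes of the hidden layers changes the scaled output only
little, except with probability `λ*`. -/
lemma card_kept_badAt_le (hℓ : 1 ≤ ℓ) (N : ReLUNetwork m)
    (hm : ∀ k : Fin (ℓ + 1), 0 < m k.castSucc)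
    (hlast : m (Fin.last (ℓ + 1)) = 1) {ε lamStar : ℝ} (hε0 : 0 < ε) (hε : ε < 1 / 2)
    (hlam0 : 0 < lamStar) (hlam : lamStar < 1 / ((ℓ : ℝ) + 1))
    (hlarge : ∀ i ≠ 0, LayerLarge m ε lamStar i) (x : Input m) (i : Fin (ℓ + 1)) :
    (#{S ∈ nodeSamples m (keptSize m ε) |
        BadAt N ((ε / 2) ^ ℓ / (8 * ((ℓ : ℝ) + 1))) 1 x i S} : ℝ)
      ≤ lamStar / ((ℓ : ℝ) + 1) * #(nodeSamples m (keptSize m ε)) := by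
  have hm0 : (0 : ℝ) < m i.castSucc := by exact_mod_cast hm i
  have hkept := le_keptSize (m := m) hε0 hε i
  have hs0 : 0 < keptSize m ε i := by
    have : (0 : ℝ) < keptSize m ε i := by linarith
    exact_mod_cast this
  have hη : 0 ≤ (ε / 2) ^ ℓ / (8 * ((ℓ : ℝ) + 1)) := by positivity
  have hM : ∀ S ∈ nodeSamples m (keptSize m ε), (#(usedNodes S i.succ) : ℝ) ≤ m i.succ := by
    intro S _
    exact_mod_cast (card_le_univ (usedNodes S i.succ)).trans_eq (Fintype.card_fin _)
  by_cases hi : i = 0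
  · have h := card_badAt_one_le N (keptSize m ε) x i
      (p := if keptSize m ε i < m i.castSucc then 2 * Real.exp
        (-(((ε / 2) ^ ℓ / (8 * ((ℓ : ℝ) + 1))) ^ 2 * keptSize m ε i / 2)) else 0)
      (by split_ifs <;> positivity)
      (fun v j hv => card_sampledSum_gt_le N i v j hs0 (keptSize_le m ε i) hη
        (layerProd_pos hm _) hv) hM
    have hnot : ¬ keptSize m ε i < m i.castSucc := by simp [keptSize, hi]
    rw [if_neg hnot, mul_zero, zero_mul] at h
    exact h.trans (by positivity)
  · have h := card_badAt_one_le N (keptSize m ε) x i (by positivity)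
      (fun v j hv => card_sampledSum_gt_le_of_compl N i v j hs0 (keptSize_le m ε i) hη
        (layerProd_pos hm _) hv (r := (m i.castSucc : ℝ) / 4) (by positivity) (by linarith)) hM
    refine h.trans (mul_le_mul_of_nonneg_right ?_ (by positivity))
    exact tail_le_of_layerLarge hℓ hm hlast hε0 hlam0 hlam (hlarge i hi) hkept

open scoped Classical in
/-- Averaging over the inputs, some choice of the deleted nodes is good for most inputs. -/
lemma exists_kept_nodes (hℓ : 1 ≤ ℓ) (N : ReLUNetwork m)
    (hm : ∀ k : Fin (ℓ + 1), 0 < m k.castSucc)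
    (hlast : m (Fin.last (ℓ + 1)) = 1) {ε lamStar : ℝ} (hε0 : 0 < ε) (hε : ε < 1 / 2)
    (hlam0 : 0 < lamStar) (hlam : lamStar < 1 / ((ℓ : ℝ) + 1))
    (hlarge : ∀ i ≠ 0, LayerLarge m ε lamStar i) :
    ∃ S ∈ nodeSamples m (keptSize m ε),
      (#{x : Input m | ∃ j,
        1 / 8 * ((ε / 2) ^ ℓ * ∏ i : Fin (ℓ + 1), (m i.castSucc : ℝ))
          < |scaledOutput (keptSize m ε) N.W S x j - layerValue N.W x (Fin.last (ℓ + 1)) j|} : ℝ)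
        ≤ lamStar * 2 ^ m 0 := by
  have hℓ0 : (0 : ℝ) < (ℓ : ℝ) + 1 := by positivity
  have hs0 : ∀ k, 0 < keptSize m ε k := by
    intro k
    have hk : (0 : ℝ) < m k.castSucc := by exact_mod_cast hm k
    have := le_keptSize (m := m) hε0 hε k
    have : (0 : ℝ) < keptSize m ε k := by linarith
    exact_mod_cast this
  have e : ((ℓ : ℝ) + 1) * ((ε / 2) ^ ℓ / (8 * ((ℓ : ℝ) + 1))
        * ∏ i : Fin (ℓ + 1), (m i.castSucc : ℝ))
      = 1 / 8 * ((ε / 2) ^ ℓ * ∏ i : Fin (ℓ + 1), (m i.castSucc : ℝ)) := by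
    field_simp
  have hx : ∀ x : Input m, _ := fun x => card_exists_scaledOutput_le N (keptSize m ε) hs0 x
    (card_kept_badAt_le hℓ N hm hlast hε0 hε hlam0 hlam hlarge x)
  rw [e] at hx
  refine exists_le_of_sum_le (f := fun S => (#{x : Input m | ∃ j,
        1 / 8 * ((ε / 2) ^ ℓ * ∏ i : Fin (ℓ + 1), (m i.castSucc : ℝ))
          < |scaledOutput (keptSize m ε) N.W S x j - layerValue N.W x (Fin.last (ℓ + 1)) j|} : ℝ))
    (g := fun _ => lamStar * 2 ^ m 0) ?_ ?_
  · exact Fintype.piFinset_nonempty.2 fun k => powersetCard_nonempty.2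
      (by rw [card_univ, Fintype.card_fin]; exact keptSize_le m ε k)
  · have hswap := sum_card_bipartiteAbove_eq_sum_card_bipartiteBelow
      (s := nodeSamples m (keptSize m ε)) (t := (univ : Finset (Input m)))
      (fun S x => ∃ j, 1 / 8 * ((ε / 2) ^ ℓ * ∏ i : Fin (ℓ + 1), (m i.castSucc : ℝ))
          < |scaledOutput (keptSize m ε) N.W S x j - layerValue N.W x (Fin.last (ℓ + 1)) j|)
    unfold bipartiteAbove bipartiteBelow at hswap
    have hswap' := congrArg (Nat.cast : ℕ → ℝ) hswap
    push_cast at hswap'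
    rw [hswap']
    refine (sum_le_sum fun x _ => hx x).trans (le_of_eq ?_)
    rw [sum_const, sum_const, card_univ, Fintype.card_fun, Fintype.card_fin, Fintype.card_bool]
    simp only [nsmul_eq_mul]
    push_cast
    ring

/-- The contribution of the path nodes to the output. -/
lemma lt_prod_pathFactor (hℓ : 1 ≤ ℓ) (hm : ∀ k : Fin (ℓ + 1), 0 < m k.castSucc)
    {ε : ℝ} (hε0 : 0 < ε) (hε : ε < 1 / 2)
    (hlarge : ∀ i : Fin (ℓ + 1), i ≠ 0 → 10 * ((ℓ : ℝ) + 1) ≤ ε / 2 * m i.castSucc)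
    {S : NodeSample m} (hS : S ∈ nodeSamples m (keptSize m ε)) {x : Input m}
    (hx : 3 / 10 * (m 0 : ℝ) < ones x) :
    1 / 4 * ((ε / 2) ^ ℓ * ∏ i : Fin (ℓ + 1), (m i.castSucc : ℝ)) < ∏ i, pathFactor S x i := by
  set β : ℝ := 1 - 1 / (10 * ((ℓ : ℝ) + 1)) with hβ
  have hβ' : 1 / (10 * ((ℓ : ℝ) + 1)) ≤ 1 := by
    rw [div_le_one (by positivity)]
    have : (0 : ℝ) ≤ ℓ := by positivity
    linarith
  have hβ0 : 0 ≤ β := by linarith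
  have hfac : ∀ i : Fin ℓ, β * (ε / 2 * m i.succ.castSucc) ≤ pathFactor S x i.succ := by
    intro i
    have hl := hlarge i.succ (Fin.succ_ne_zero i)
    have hfl : ⌊ε / 2 * (m i.succ.castSucc : ℝ)⌋₊ ≤ m i.succ.castSucc := by
      have h1 := floor_le_of_lt_half hε0 hε (m i.succ.castSucc)
      have h2 : (0 : ℝ) ≤ m i.succ.castSucc := by positivity
      have : (⌊ε / 2 * (m i.succ.castSucc : ℝ)⌋₊ : ℝ) ≤ m i.succ.castSucc := by linarith
      exact_mod_cast this
    have hcard : #(S i.succ)ᶜ = ⌊ε / 2 * (m i.succ.castSucc : ℝ)⌋₊ := by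
      rw [card_compl, card_of_mem_nodeSamples hS, Fintype.card_fin, keptSize,
        if_neg (Fin.succ_ne_zero i)]
      omega
    rw [pathFactor, if_neg (Fin.succ_ne_zero i), hcard]
    have hfloor := Nat.lt_floor_add_one (ε / 2 * (m i.succ.castSucc : ℝ))
    have h1 : 1 ≤ 1 / (10 * ((ℓ : ℝ) + 1)) * (ε / 2 * m i.succ.castSucc) := by
      rw [one_div_mul_eq_div, le_div_iff₀ (by positivity)]
      linarith
    rw [hβ, sub_mul, one_mul]
    linarith
  have hprod : ∏ i : Fin ℓ, (β * (ε / 2 * (m i.succ.castSucc : ℝ)))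
      ≤ ∏ i : Fin ℓ, pathFactor S x i.succ :=
    prod_le_prod (fun i _ => by positivity) fun i _ => hfac i
  rw [prod_mul_distrib, prod_mul_distrib, prod_const, prod_const, card_univ, Fintype.card_fin]
    at hprod
  have hβℓ : 9 / 10 ≤ β ^ ℓ := by
    have hb := one_add_mul_le_pow (a := -(1 / (10 * ((ℓ : ℝ) + 1)))) (by linarith) ℓ
    rw [← sub_eq_add_neg, ← hβ] at hb
    refine le_trans ?_ hb
    have : (ℓ : ℝ) * (1 / (10 * ((ℓ : ℝ) + 1))) ≤ 1 / 10 := by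
      rw [mul_one_div, div_le_div_iff₀ (by positivity) (by norm_num)]
      linarith
    linarith
  have h0 : pathFactor S x 0 = ones x := by simp [pathFactor]
  rw [Fin.prod_univ_succ, Fin.prod_univ_succ, h0]
  have hP : (0 : ℝ) < ∏ i : Fin ℓ, (m i.succ.castSucc : ℝ) :=
    prod_pos fun i _ => by exact_mod_cast hm i.succ
  have hm0 : (0 : ℝ) < m (Fin.castSucc 0) := by exact_mod_cast hm 0
  have hm0' : (m (Fin.castSucc 0) : ℝ) = m 0 := rfl
  set R : ℝ := ∏ i : Fin ℓ, (m i.succ.castSucc : ℝ) with hR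
  have hE : 0 < (ε / 2) ^ ℓ * R := by positivity
  have h1 : 9 / 10 * ((ε / 2) ^ ℓ * R) ≤ ∏ i : Fin ℓ, pathFactor S x i.succ :=
    (mul_le_mul_of_nonneg_right hβℓ hE.le).trans hprod
  rw [hm0'] at hm0 ⊢
  calc 1 / 4 * ((ε / 2) ^ ℓ * ((m 0 : ℝ) * R))
      = 1 / 4 * m 0 * ((ε / 2) ^ ℓ * R) := by ring
    _ < 3 / 10 * m 0 * (9 / 10 * ((ε / 2) ^ ℓ * R)) := by nlinarith [mul_pos hm0 hE]
    _ ≤ ones x * ∏ i : Fin ℓ, pathFactor S x i.succ := by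
        refine mul_le_mul hx.le h1 (by positivity) (by positivity)

/-- If all outputs of `N`, multiplied by the sign `σ`, are small, then `N` is close to computing any
function `f` that agrees at the inputs `x ≠ 0` with every network whose output there has sign `-σ`. -/
theorem isClose_of_forall_le (hℓ : 1 ≤ ℓ) (N : ReLUNetwork m)
    (hm : ∀ k : Fin (ℓ + 1), 0 < m k.castSucc)
    (hlast : m (Fin.last (ℓ + 1)) = 1) {ε lamStar δ : ℝ} (hε0 : 0 < ε) (hε : ε < 1 / 2)
    (hlam0 : 0 < lamStar) (hlam : lamStar < 1 / ((ℓ : ℝ) + 1))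
    (hlarge : ∀ i ≠ 0, LayerLarge m ε lamStar i)
    (hδ : lamStar + Real.exp (-(m 0 : ℝ) / 16) ≤ δ)
    {σ : ℝ} (hσ : σ ^ 2 = 1) (f : Input m → Output m)
    (hf : ∀ (N' : ReLUNetwork m) (x : Input m), 0 < ones x →
      (∀ j, σ * layerValue N'.W x (Fin.last (ℓ + 1)) j < 0) → N'.computed x = f x)
    (hsmall : ∀ x j, σ * layerValue N.W x (Fin.last (ℓ + 1)) j
      ≤ 1 / 8 * ((ε / 2) ^ ℓ * ∏ i : Fin (ℓ + 1), (m i.castSucc : ℝ))) :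
    IsClose ε δ N f := by
  classical
  obtain ⟨S, hS, hSx⟩ := exists_kept_nodes hℓ N hm hlast hε0 hε hlam0 hlam hlarge
  have hσ1 : |σ| ≤ 1 := by
    rw [← sq_le_one_iff_abs_le_one, hσ]
  have hσabs : |σ| = 1 := by
    have := sq_abs σ
    rw [hσ] at this
    nlinarith [abs_nonneg σ]
  have hS0 : S 0 = univ := eq_univ_of_card _ (by
    rw [card_of_mem_nodeSamples hS, keptSize, if_pos rfl, Fintype.card_fin])
  refine ⟨pathNetwork σ hσ1 N S, card_pathNetwork_ne_le σ hσ1 N S ?_, ?_⟩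
  · intro k
    cases k using Fin.lastCases with
    | last => rw [usedNodes_last, compl_univ, card_empty, Nat.cast_zero]; positivity
    | cast i =>
      rw [usedNodes_castSucc]
      by_cases hi : i = 0
      · subst hi; rw [hS0, compl_univ, card_empty, Nat.cast_zero]; positivity
      · have h1 : #(S i)ᶜ ≤ ⌊ε / 2 * (m i.castSucc : ℝ)⌋₊ := by
          rw [card_compl, card_of_mem_nodeSamples hS, Fintype.card_fin, keptSize, if_neg hi]
          omega
        exact (Nat.cast_le.2 h1).trans (Nat.floor_le (by positivity))
  · set P : ℝ := (ε / 2) ^ ℓ * ∏ i : Fin (ℓ + 1), (m i.castSucc : ℝ) with hP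
    have hP0 : 0 ≤ P := by positivity
    have hgood : ∀ x : Input m, 3 / 10 * (m 0 : ℝ) < ones x →
        (∀ j, |scaledOutput (keptSize m ε) N.W S x j - layerValue N.W x (Fin.last (ℓ + 1)) j|
          ≤ 1 / 8 * P) →
        (pathNetwork σ hσ1 N S).computed x = f x := by
      intro x hx hj
      refine hf _ x ?_ fun j => ?_
      · have h1 : (0 : ℝ) < ones x := lt_of_le_of_lt (by positivity) hx
        exact_mod_cast h1
      · have hval := layerValue_pathWeights hℓ σ N.W S hS0 x (Fin.last (ℓ + 1)) j
        rw [usedNodes_last, if_pos (mem_univ _), if_pos rfl, partialProd_last] at hval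
        have hpath := lt_prod_pathFactor hℓ hm hε0 hε
          (fun i hi => ten_mul_le_of_layerLarge hℓ hm hε0 hε hlam0 hlam (hlarge i hi)) hS hx
        have hscaled : σ * scaledOutput (keptSize m ε) N.W S x j ≤ 1 / 4 * P := by
          have h1 : σ * (scaledOutput (keptSize m ε) N.W S x j
              - layerValue N.W x (Fin.last (ℓ + 1)) j) ≤ 1 / 8 * P := by
            refine (le_abs_self _).trans ?_
            rw [abs_mul, hσabs, one_mul]
            exact hj j
          have h2 := hsmall x j
          linarith
        have hsampled : σ * sampledValue N.W S x (Fin.last (ℓ + 1)) j ≤ 1 / 4 * P := by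
          rcases le_total (σ * sampledValue N.W S x (Fin.last (ℓ + 1)) j) 0 with h | h
          · exact h.trans (by positivity)
          · have hratio : 1 ≤ ∏ i : Fin (ℓ + 1), (m i.castSucc : ℝ) / (keptSize m ε i : ℝ) := by
              rw [← prod_const_one (s := (univ : Finset (Fin (ℓ + 1))))]
              refine prod_le_prod (fun _ _ => zero_le_one) fun i _ => ?_
              have hk := le_keptSize (m := m) hε0 hε i
              have hmi : (0 : ℝ) < m i.castSucc := by exact_mod_cast hm i
              rw [one_le_div (by linarith)]
              exact_mod_cast keptSize_le m ε i
            refine le_trans ?_ hscaled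
            rw [scaledOutput, mul_left_comm]
            exact le_mul_of_one_le_left h hratio
        change σ * layerValue (pathWeights σ N.W S) x (Fin.last (ℓ + 1)) j < 0
        rw [hval, mul_sub, ← mul_assoc, ← sq, hσ, one_mul]
        linarith
    unfold disagreement
    rw [div_le_iff₀ (by positivity)]
    have hsub : ({x | (pathNetwork σ hσ1 N S).computed x ≠ f x} : Finset (Input m))
        ⊆ (univ.filter fun x : Input m => ∃ j, 1 / 8 * P
          < |scaledOutput (keptSize m ε) N.W S x j - layerValue N.W x (Fin.last (ℓ + 1)) j|)
        ∪ univ.filter fun x : Input m => (ones x : ℝ) ≤ 3 / 10 * m 0 := by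
      intro x hx
      simp only [mem_union, mem_filter, mem_univ, true_and] at hx ⊢
      by_contra hno
      push Not at hno
      exact hx (hgood x hno.2 hno.1)
    calc ((#{x | (pathNetwork σ hσ1 N S).computed x ≠ f x} : ℕ) : ℝ)
        ≤ (#{x : Input m | ∃ j, 1 / 8 * P
          < |scaledOutput (keptSize m ε) N.W S x j - layerValue N.W x (Fin.last (ℓ + 1)) j|} : ℝ)
          + #{x : Input m | (ones x : ℝ) ≤ 3 / 10 * m 0} := by
          exact_mod_cast (card_le_card hsub).trans (card_union_le _ _)
      _ ≤ lamStar * 2 ^ m 0 + Real.exp (-(m 0 : ℝ) / 16) * 2 ^ m 0 :=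
          add_le_add hSx (card_ones_le_le m)
      _ = (lamStar + Real.exp (-(m 0 : ℝ) / 16)) * 2 ^ m 0 := by ring
      _ ≤ δ * 2 ^ m 0 := by gcongr

end Close

/-! ### Constants and sample sizes -/

/-- The reciprocal of the constant in the exponent of the tail bound: with
`η = (ε/2)^ℓ / (16 (ℓ+1))`, we have `η² / 2 = ε^(2ℓ) / tailConst ℓ`. -/
noncomputable def tailConst (ℓ : ℕ) : ℝ := 512 * 4 ^ ℓ * ((ℓ : ℝ) + 1) ^ 2

lemma one_le_tailConst (ℓ : ℕ) : 1 ≤ tailConst ℓ := by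
  unfold tailConst
  have h1 : (1 : ℝ) ≤ 4 ^ ℓ := one_le_pow₀ (by norm_num)
  have h2 : (1 : ℝ) ≤ ((ℓ : ℝ) + 1) ^ 2 := one_le_pow₀ (by simp)
  nlinarith

/-- The exponent achieved in units of `ln (1/(λε))`. It has to beat the logarithm of the sample sizes,
which depend on it only linearly. -/
noncomputable def tailExponent (ℓ : ℕ) : ℝ :=
  24 * tailConst ℓ ^ 2 * ((ℓ : ℝ) + 1) * Real.exp (4 * ℓ + 3)

lemma le_tailExponent (ℓ : ℕ) : 4 * (ℓ : ℝ) + 4 ≤ tailExponent ℓ := by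
  have h1 : 4 * (ℓ : ℝ) + 4 ≤ Real.exp (4 * ℓ + 3) := by
    have := Real.add_one_le_exp (4 * (ℓ : ℝ) + 3)
    linarith
  refine h1.trans ?_
  unfold tailExponent
  refine le_mul_of_one_le_left (Real.exp_pos _).le ?_
  have h2 : 1 ≤ tailConst ℓ ^ 2 := one_le_pow₀ (one_le_tailConst ℓ)
  have h3 : (1 : ℝ) ≤ (ℓ : ℝ) + 1 := by simp
  nlinarith

lemma mul_tailExponent_le (ℓ : ℕ) :
    12 * tailConst ℓ ^ 2 * ((ℓ : ℝ) + 1) * tailExponent ℓ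
      ≤ Real.exp (tailExponent ℓ - (4 * ℓ + 3)) := by
  have hu : 0 ≤ tailExponent ℓ := le_trans (by positivity) (le_tailExponent ℓ)
  have h := Real.quadratic_le_exp_of_nonneg hu
  rw [Real.exp_sub, le_div_iff₀ (Real.exp_pos _)]
  have e : 12 * tailConst ℓ ^ 2 * ((ℓ : ℝ) + 1) * tailExponent ℓ * Real.exp (4 * ℓ + 3)
      = tailExponent ℓ ^ 2 / 2 := by
    rw [sq (tailExponent ℓ)]
    nth_rw 2 [tailExponent]
    ring
  linarith

/-- The constants `c_k` in the sample sizes. -/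
noncomputable def sizeConst (ℓ : ℕ) (k : Fin (ℓ + 1)) : ℝ :=
  if k = 0 then tailConst ℓ * tailExponent ℓ else 3 * tailConst ℓ ^ 2 * tailExponent ℓ

/-- An upper bound for the constants `c_k`. -/
noncomputable def maxSizeConst (ℓ : ℕ) : ℝ := 3 * tailConst ℓ ^ 2 * tailExponent ℓ

lemma one_le_tailExponent (ℓ : ℕ) : 1 ≤ tailExponent ℓ := by
  have h1 := le_tailExponent ℓ
  have h2 : (0 : ℝ) ≤ ℓ := by positivity
  linarith

lemma one_le_sizeConst (ℓ : ℕ) (k : Fin (ℓ + 1)) : 1 ≤ sizeConst ℓ k := by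
  have h1 := one_le_tailConst ℓ
  have h2 := one_le_tailExponent ℓ
  unfold sizeConst
  split_ifs
  · exact one_le_mul_of_one_le_of_one_le h1 h2
  · exact one_le_mul_of_one_le_of_one_le (by nlinarith) h2

lemma sizeConst_le (ℓ : ℕ) (k : Fin (ℓ + 1)) : sizeConst ℓ k ≤ maxSizeConst ℓ := by
  have h1 := one_le_tailConst ℓ
  have h2 := one_le_tailExponent ℓ
  unfold sizeConst maxSizeConst
  split_ifs
  · gcongr
    nlinarith
  · exact le_rfl

lemma one_le_maxSizeConst (ℓ : ℕ) : 1 ≤ maxSizeConst ℓ :=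
  (one_le_sizeConst ℓ 0).trans (sizeConst_le ℓ 0)

section Numerics

variable {ℓ : ℕ} {ε lam : ℝ}

lemma lam_lt_half (hℓ : 1 ≤ ℓ) (hlam : lam < 1 / ((ℓ : ℝ) + 1)) : lam < 1 / 2 := by
  have hℓ1 : (1 : ℝ) ≤ ℓ := by exact_mod_cast hℓ
  refine hlam.trans_le (one_div_le_one_div_of_le (by norm_num) (by linarith))

lemma one_le_log (hε0 : 0 < ε) (hε : ε < 1 / 2) (hlam0 : 0 < lam) (hlam : lam < 1 / 2) :
    1 ≤ Real.log (1 / (lam * ε)) := by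
  rw [Real.le_log_iff_exp_le (by positivity), le_div_iff₀ (by positivity)]
  have h1 : lam * ε < 1 / 4 := by nlinarith
  have h2 := Real.exp_one_lt_d9
  have h3 : 0 < lam * ε := by positivity
  nlinarith [Real.exp_pos 1]

lemma one_div_le_exp_log (hε0 : 0 < ε) (hlam0 : 0 < lam) (hlam : lam < 1 / 2) :
    1 / ε ≤ Real.exp (Real.log (1 / (lam * ε))) := by
  rw [Real.exp_log (by positivity)]
  exact one_div_le_one_div_of_le (by positivity) (by nlinarith)

lemma exp_neg_log_le (hε0 : 0 < ε) (hε : ε < 1 / 2) (hlam0 : 0 < lam) :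
    Real.exp (-Real.log (1 / (lam * ε))) ≤ lam := by
  rw [Real.exp_neg, Real.exp_log (by positivity), one_div, inv_inv]
  nlinarith

/-- The failure probability of a layer whose tail bound has the exponent `tailExponent · ln (1/(λε))`,
after the union bound over the sampled nodes of the next layer. -/
lemma mul_exp_neg_le (hℓ : 1 ≤ ℓ) (hε0 : 0 < ε) (hε : ε < 1 / 2) (hlam0 : 0 < lam)
    (hlam : lam < 1 / ((ℓ : ℝ) + 1)) :
    2 * maxSizeConst ℓ * (1 / ε) ^ (4 * ℓ) * Real.log (1 / (lam * ε)) ^ 2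
        * (2 * Real.exp (-(tailExponent ℓ * Real.log (1 / (lam * ε)))))
      ≤ lam / ((ℓ : ℝ) + 1) := by
  have hlam2 := lam_lt_half hℓ hlam
  have hL := one_le_log hε0 hε hlam0 hlam2
  have hE := one_div_le_exp_log hε0 hlam0 hlam2
  have hlamL := exp_neg_log_le hε0 hε hlam0
  set L := Real.log (1 / (lam * ε)) with hLdef
  have hC := one_le_maxSizeConst ℓ
  have hℓ0 : (0 : ℝ) < (ℓ : ℝ) + 1 := by positivity
  have hE4 : (1 / ε) ^ (4 * ℓ) ≤ Real.exp (4 * ℓ * L) := by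
    have e : Real.exp (4 * ℓ * L) = Real.exp L ^ (4 * ℓ) := by
      rw [← Real.exp_nat_mul]; push_cast; ring_nf
    rw [e]
    gcongr
  have hL2 : L ^ 2 ≤ Real.exp (2 * L) := by
    have e : Real.exp (2 * L) = Real.exp L ^ 2 := by
      rw [← Real.exp_nat_mul]; norm_num
    rw [e]
    have := Real.add_one_le_exp L
    gcongr
    linarith
  have hbig : 4 * maxSizeConst ℓ * ((ℓ : ℝ) + 1)
      ≤ Real.exp ((tailExponent ℓ - (4 * ℓ + 3)) * L) := by
    have h1 := mul_tailExponent_le ℓ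
    have h2 : 4 * maxSizeConst ℓ * ((ℓ : ℝ) + 1)
        = 12 * tailConst ℓ ^ 2 * ((ℓ : ℝ) + 1) * tailExponent ℓ := by
      unfold maxSizeConst; ring
    rw [h2]
    refine h1.trans (Real.exp_le_exp.2 (le_mul_of_one_le_right ?_ hL))
    have := le_tailExponent ℓ
    linarith
  rw [le_div_iff₀ hℓ0]
  calc 2 * maxSizeConst ℓ * (1 / ε) ^ (4 * ℓ) * L ^ 2
        * (2 * Real.exp (-(tailExponent ℓ * L))) * ((ℓ : ℝ) + 1)
      = (4 * maxSizeConst ℓ * ((ℓ : ℝ) + 1)) * (1 / ε) ^ (4 * ℓ) * L ^ 2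
        * Real.exp (-(tailExponent ℓ * L)) := by ring
    _ ≤ Real.exp ((tailExponent ℓ - (4 * ℓ + 3)) * L) * Real.exp (4 * ℓ * L) * Real.exp (2 * L)
        * Real.exp (-(tailExponent ℓ * L)) := by gcongr
    _ = Real.exp (-L) := by
        rw [← Real.exp_add, ← Real.exp_add, ← Real.exp_add]
        congr 1
        ring
    _ ≤ lam := hlamL

lemma ceil_le_two_mul {y : ℝ} (hy : 1 ≤ y) : (⌈y⌉₊ : ℝ) ≤ 2 * y := by
  have := Nat.ceil_lt_add_one (by linarith : (0 : ℝ) ≤ y)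
  linarith

lemma le_nominalSize_zero (c : Fin (ℓ + 1) → ℝ) (ε lam : ℝ) :
    c 0 * (1 / ε) ^ (2 * ℓ) * Real.log (1 / (lam * ε)) ≤ nominalSize c ε lam 0 := by
  rw [nominalSize, if_pos rfl]; exact Nat.le_ceil _

lemma le_nominalSize (c : Fin (ℓ + 1) → ℝ) (ε lam : ℝ) {k : Fin (ℓ + 1)} (hk : k ≠ 0) :
    c k * (1 / ε) ^ (4 * ℓ) * Real.log (1 / (lam * ε)) ^ 2 ≤ nominalSize c ε lam k := by
  rw [nominalSize, if_neg hk]; exact Nat.le_ceil _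

lemma nominalSize_zero_le {c : Fin (ℓ + 1) → ℝ} (hc : 1 ≤ c 0) (hε0 : 0 < ε) (hε : ε < 1 / 2)
    (hL : 1 ≤ Real.log (1 / (lam * ε))) :
    (nominalSize c ε lam 0 : ℝ) ≤ 2 * (c 0 * (1 / ε) ^ (2 * ℓ) * Real.log (1 / (lam * ε))) := by
  rw [nominalSize, if_pos rfl]
  have hE : 1 ≤ (1 / ε) ^ (2 * ℓ) := one_le_pow₀ (by rw [le_div_iff₀ hε0]; linarith)
  exact ceil_le_two_mul
    (one_le_mul_of_one_le_of_one_le (one_le_mul_of_one_le_of_one_le hc hE) hL)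

lemma nominalSize_le {c : Fin (ℓ + 1) → ℝ} {k : Fin (ℓ + 1)} (hc : 1 ≤ c k) (hε0 : 0 < ε)
    (hε : ε < 1 / 2) (hL : 1 ≤ Real.log (1 / (lam * ε))) (hk : k ≠ 0) :
    (nominalSize c ε lam k : ℝ)
      ≤ 2 * (c k * (1 / ε) ^ (4 * ℓ) * Real.log (1 / (lam * ε)) ^ 2) := by
  rw [nominalSize, if_neg hk]
  have hE : 1 ≤ (1 / ε) ^ (4 * ℓ) := one_le_pow₀ (by rw [le_div_iff₀ hε0]; linarith)
  exact ceil_le_two_mul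
    (one_le_mul_of_one_le_of_one_le (one_le_mul_of_one_le_of_one_le hc hE) (one_le_pow₀ hL))

lemma nominalSize_pos {c : Fin (ℓ + 1) → ℝ} {k : Fin (ℓ + 1)} (hc : 1 ≤ c k) (hε0 : 0 < ε)
    (hL : 1 ≤ Real.log (1 / (lam * ε))) : 0 < nominalSize c ε lam k := by
  unfold nominalSize
  split_ifs <;> exact Nat.ceil_pos.2 (by positivity)

variable {m : Fin (ℓ + 2) → ℕ}

lemma sampleSize_eq_of_lt {c : Fin (ℓ + 1) → ℝ} {k : Fin (ℓ + 1)}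
    (h : sampleSize m c ε lam k < m k.castSucc) : sampleSize m c ε lam k = nominalSize c ε lam k := by
  unfold sampleSize at h ⊢; omega

lemma sampleSize_le_nominalSize (m : Fin (ℓ + 2) → ℕ) (c : Fin (ℓ + 1) → ℝ) (ε lam : ℝ)
    (k : Fin (ℓ + 1)) : (sampleSize m c ε lam k : ℝ) ≤ nominalSize c ε lam k := by
  exact_mod_cast min_le_left _ _

lemma sampleSize_le_of_ne_zero (hε0 : 0 < ε) (hε : ε < 1 / 2)
    (hL : 1 ≤ Real.log (1 / (lam * ε))) {k : Fin (ℓ + 1)} (hk : k ≠ 0) :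
    (sampleSize m (sizeConst ℓ) ε lam k : ℝ)
      ≤ 2 * maxSizeConst ℓ * (1 / ε) ^ (4 * ℓ) * Real.log (1 / (lam * ε)) ^ 2 := by
  refine (sampleSize_le_nominalSize m _ ε lam k).trans
    ((nominalSize_le (one_le_sizeConst ℓ k) hε0 hε hL hk).trans ?_)
  rw [mul_assoc 2, mul_assoc 2]
  have := sizeConst_le ℓ k
  gcongr

lemma sampleSize_zero_le (hε0 : 0 < ε) (hε : ε < 1 / 2)
    (hL : 1 ≤ Real.log (1 / (lam * ε))) :
    (sampleSize m (sizeConst ℓ) ε lam 0 : ℝ)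
      ≤ 2 * maxSizeConst ℓ * (1 / ε) ^ (2 * ℓ) * Real.log (1 / (lam * ε)) := by
  refine (sampleSize_le_nominalSize m _ ε lam 0).trans
    ((nominalSize_zero_le (one_le_sizeConst ℓ 0) hε0 hε hL).trans ?_)
  rw [mul_assoc 2, mul_assoc 2]
  have := sizeConst_le ℓ 0
  gcongr

lemma sq_half_mul (ℓ : ℕ) {ε : ℝ} (s : ℝ) :
    ((ε / 2) ^ ℓ / (16 * ((ℓ : ℝ) + 1))) ^ 2 * s / 2 = ε ^ (2 * ℓ) / tailConst ℓ * s := by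
  have h4 : (4 : ℝ) ^ ℓ = (2 ^ ℓ) ^ 2 := by rw [← pow_mul, mul_comm, pow_mul]; norm_num
  rw [tailConst, h4, pow_mul' ε 2 ℓ, div_pow ε 2 ℓ]
  field_simp
  ring

/-- The tail of the input layer. -/
lemma exponent_zero_le (hε0 : 0 < ε)
    (h : sampleSize m (sizeConst ℓ) ε lam 0 < m (Fin.castSucc 0)) :
    tailExponent ℓ * Real.log (1 / (lam * ε))
      ≤ ((ε / 2) ^ ℓ / (16 * ((ℓ : ℝ) + 1))) ^ 2 * sampleSize m (sizeConst ℓ) ε lam 0 / 2 := by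
  have hK : 0 < tailConst ℓ := by linarith [one_le_tailConst ℓ]
  rw [sampleSize_eq_of_lt h, sq_half_mul]
  have h1 := le_nominalSize_zero (sizeConst ℓ) ε lam
  rw [show sizeConst ℓ 0 = tailConst ℓ * tailExponent ℓ by simp [sizeConst]] at h1
  refine le_trans (le_of_eq ?_) (mul_le_mul_of_nonneg_left h1 (by positivity))
  have e : ε ^ (2 * ℓ) * (1 / ε) ^ (2 * ℓ) = 1 := by
    rw [← mul_pow, mul_one_div_cancel hε0.ne', one_pow]
  calc _ = (ε ^ (2 * ℓ) * (1 / ε) ^ (2 * ℓ)) * (tailExponent ℓ * Real.log (1 / (lam * ε))) := by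
        rw [e, one_mul]
    _ = _ := by field_simp

/-- The tail of the other layers suffices for a union bound over the `2 ^ s_0` sampled inputs. -/
lemma two_pow_mul_exp_le (hε0 : 0 < ε) (hε : ε < 1 / 2)
    (hL : 1 ≤ Real.log (1 / (lam * ε))) {i : Fin (ℓ + 1)} (hi : i ≠ 0)
    (h : sampleSize m (sizeConst ℓ) ε lam i < m i.castSucc) :
    2 ^ sampleSize m (sizeConst ℓ) ε lam 0 * Real.exp (-(((ε / 2) ^ ℓ / (16 * ((ℓ : ℝ) + 1))) ^ 2
        * sampleSize m (sizeConst ℓ) ε lam i / 2))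
      ≤ Real.exp (-(tailExponent ℓ * Real.log (1 / (lam * ε)))) := by
  have hK1 := one_le_tailConst ℓ
  have hu := one_le_tailExponent ℓ
  set L := Real.log (1 / (lam * ε)) with hLdef
  have hE : 1 ≤ (1 / ε) ^ (2 * ℓ) := one_le_pow₀ (by rw [le_div_iff₀ hε0]; linarith)
  have hs0 : (sampleSize m (sizeConst ℓ) ε lam 0 : ℝ)
      ≤ 2 * (tailConst ℓ * tailExponent ℓ * (1 / ε) ^ (2 * ℓ) * L) := by
    have := nominalSize_zero_le (one_le_sizeConst ℓ 0) hε0 hε hL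
    rw [show sizeConst ℓ 0 = tailConst ℓ * tailExponent ℓ by simp [sizeConst]] at this
    exact (sampleSize_le_nominalSize m _ ε lam 0).trans this
  have h2 : (2 : ℝ) ^ sampleSize m (sizeConst ℓ) ε lam 0
      ≤ Real.exp (2 * (tailConst ℓ * tailExponent ℓ * (1 / ε) ^ (2 * ℓ) * L)) := by
    have h2e : (2 : ℝ) ≤ Real.exp 1 := by linarith [Real.exp_one_gt_d9]
    calc (2 : ℝ) ^ sampleSize m (sizeConst ℓ) ε lam 0
        ≤ Real.exp 1 ^ sampleSize m (sizeConst ℓ) ε lam 0 := by gcongr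
      _ = Real.exp (sampleSize m (sizeConst ℓ) ε lam 0) := by rw [← Real.exp_nat_mul, mul_one]
      _ ≤ _ := Real.exp_le_exp.2 hs0
  have hsi : 3 * (tailConst ℓ * tailExponent ℓ * (1 / ε) ^ (2 * ℓ) * L ^ 2)
      ≤ ((ε / 2) ^ ℓ / (16 * ((ℓ : ℝ) + 1))) ^ 2 * sampleSize m (sizeConst ℓ) ε lam i / 2 := by
    rw [sampleSize_eq_of_lt h, sq_half_mul]
    have h1 := le_nominalSize (sizeConst ℓ) ε lam hi
    rw [show sizeConst ℓ i = 3 * tailConst ℓ ^ 2 * tailExponent ℓ by simp [sizeConst, hi],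
      ← hLdef] at h1
    refine le_trans (le_of_eq ?_) (mul_le_mul_of_nonneg_left h1 (by positivity))
    have e : ε ^ (2 * ℓ) * (1 / ε) ^ (4 * ℓ) = (1 / ε) ^ (2 * ℓ) := by
      rw [show 4 * ℓ = 2 * ℓ + 2 * ℓ by ring, pow_add, ← mul_assoc, ← mul_pow,
        mul_one_div_cancel hε0.ne', one_pow, one_mul]
    rw [← e]
    field_simp
  have hLL : L ≤ L ^ 2 := by nlinarith
  set G := tailConst ℓ * tailExponent ℓ * (1 / ε) ^ (2 * ℓ) with hG
  have hGu : tailExponent ℓ ≤ G := by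
    rw [hG, mul_comm (tailConst ℓ), mul_assoc]
    exact le_mul_of_one_le_right (by linarith) (one_le_mul_of_one_le_of_one_le hK1 hE)
  calc _ ≤ Real.exp (2 * (G * L)) * Real.exp (-(3 * (G * L ^ 2))) := by gcongr
    _ = Real.exp (2 * (G * L) - 3 * (G * L ^ 2)) := by rw [← Real.exp_add, sub_eq_add_neg]
    _ ≤ _ := by
        refine Real.exp_le_exp.2 ?_
        have h3 : G * L ≤ G * L ^ 2 := mul_le_mul_of_nonneg_left hLL (by linarith)
        have h4 : tailExponent ℓ * L ≤ G * L := mul_le_mul_of_nonneg_right hGu (by linarith)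
        linarith

end Numerics

/-! ### Number of queries -/

section Queries

variable {ℓ : ℕ} {m : Fin (ℓ + 2) → ℕ}

lemma card_inducedEdges (S : NodeSample m) :
    #(inducedEdges S) = ∑ i : Fin (ℓ + 1), #(usedNodes S i.succ) * #(S i) := by
  have h : inducedEdges S = univ.sigma fun i : Fin (ℓ + 1) => usedNodes S i.succ ×ˢ S i := by
    ext e
    simp [inducedEdges]
  rw [h, card_sigma]
  exact sum_congr rfl fun i _ => card_product _ _

lemma card_usedNodes_eq {s : Fin (ℓ + 1) → ℕ} {S : NodeSample m} (hS : S ∈ nodeSamples m s)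
    {k : Fin (ℓ + 2)} {i : Fin (ℓ + 1)} (h : k = i.castSucc) : #(usedNodes S k) = s i := by
  subst h
  rw [usedNodes_castSucc, card_of_mem_nodeSamples hS]

lemma queryBound_inducedEdges (hℓ : 1 ≤ ℓ) (hlast : m (Fin.last (ℓ + 1)) = 1) {ε lam : ℝ}
    (hε0 : 0 < ε) (hε : ε < 1 / 2) (hlam0 : 0 < lam) (hlam : lam < 1 / ((ℓ : ℝ) + 1))
    {S : NodeSample m} (hS : S ∈ nodeSamples m (sampleSize m (sizeConst ℓ) ε lam)) :
    QueryBound ℓ 1 (((ℓ : ℝ) + 1) * (2 * maxSizeConst ℓ) ^ 2) ε lam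
      (∀ k, nominalSize (sizeConst ℓ) ε lam k ≤ m k.castSucc) #(inducedEdges S) := by
  have hL := one_le_log hε0 hε hlam0 (lam_lt_half hℓ hlam)
  have hE1 : 1 ≤ 1 / ε := by rw [le_div_iff₀ hε0]; linarith
  have hC := one_le_maxSizeConst ℓ
  unfold QueryBound
  set s := sampleSize m (sizeConst ℓ) ε lam with hs
  have hszero : (s 0 : ℝ) ≤ 2 * maxSizeConst ℓ * (1 / ε) ^ (2 * ℓ) * Real.log (1 / (lam * ε)) :=
    sampleSize_zero_le hε0 hε hL
  have hsi : ∀ i : Fin (ℓ + 1), i ≠ 0 → (s i : ℝ)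
      ≤ 2 * maxSizeConst ℓ * (1 / ε) ^ (4 * ℓ) * Real.log (1 / (lam * ε)) ^ 2 := fun i hi =>
    sampleSize_le_of_ne_zero hε0 hε hL hi
  have hfull : (∀ k, nominalSize (sizeConst ℓ) ε lam k ≤ m k.castSucc) →
      ∀ k, s k = nominalSize (sizeConst ℓ) ε lam k := fun h k => min_eq_left (h k)
  have hlow0 := le_nominalSize_zero (sizeConst ℓ) ε lam
  have hlow : ∀ k : Fin (ℓ + 1), k ≠ 0 → _ := fun k hk => le_nominalSize (sizeConst ℓ) ε lam hk
  set L := Real.log (1 / (lam * ε)) with hLdef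
  set E := 1 / ε with hEdef
  have hcard : (#(inducedEdges S) : ℝ)
      = ∑ i : Fin (ℓ + 1), (#(usedNodes S i.succ) : ℝ) * s i := by
    rw [card_inducedEdges]
    push_cast
    exact sum_congr rfl fun i _ => by rw [card_of_mem_nodeSamples hS]
  have hM1 : 1 ≤ 2 * maxSizeConst ℓ * E ^ (4 * ℓ) * L ^ 2 :=
    one_le_mul_of_one_le_of_one_le
      (one_le_mul_of_one_le_of_one_le (by linarith) (one_le_pow₀ hE1)) (one_le_pow₀ hL)
  have hused := card_usedNodes_succ_le hS hlast hM1 hsi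
  have hall : ∀ i, (s i : ℝ) ≤ 2 * maxSizeConst ℓ * E ^ (4 * ℓ) * L ^ 2 := by
    intro i
    by_cases hi : i = 0
    · subst hi
      refine hszero.trans ?_
      have h1 : E ^ (2 * ℓ) ≤ E ^ (4 * ℓ) := pow_le_pow_right₀ hE1 (by omega)
      have h2 : L ≤ L ^ 2 := by nlinarith
      gcongr
    · exact hsi i hi
  have hterm : ∀ i : Fin (ℓ + 1), (#(usedNodes S i.succ) : ℝ) * s i ≤ #(inducedEdges S) := by
    intro i
    rw [hcard]
    exact single_le_sum (f := fun i : Fin (ℓ + 1) => (#(usedNodes S i.succ) : ℝ) * s i)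
      (fun i _ => by positivity) (mem_univ i)
  refine ⟨?_, ?_, ?_⟩
  · rw [hcard]
    calc _ ≤ ∑ i : Fin (ℓ + 1), (2 * maxSizeConst ℓ * E ^ (4 * ℓ) * L ^ 2)
          * (2 * maxSizeConst ℓ * E ^ (4 * ℓ) * L ^ 2) :=
          sum_le_sum fun i _ => mul_le_mul (hused i) (hall i) (by positivity) (by linarith)
      _ = _ := by
          rw [sum_const, card_univ, Fintype.card_fin, nsmul_eq_mul]
          rw [show 8 * ℓ = 4 * ℓ + 4 * ℓ by ring, pow_add]
          push_cast
          ring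
  · intro h2 henough
    -- the edges between the sampled nodes of layers `1` and `2`
    have h1ne : (⟨1, by omega⟩ : Fin (ℓ + 1)) ≠ 0 := by
      intro h; simpa using congrArg Fin.val h
    have h2ne : (⟨2, by omega⟩ : Fin (ℓ + 1)) ≠ 0 := by
      intro h; simpa using congrArg Fin.val h
    refine le_trans ?_ (hterm ⟨1, by omega⟩)
    rw [card_usedNodes_eq hS (k := Fin.succ ⟨1, by omega⟩) (i := ⟨2, by omega⟩) rfl, hfull henough, hfull henough, one_mul]
    have ha := hlow _ h1ne
    have hb := hlow _ h2ne
    have hca := one_le_sizeConst ℓ ⟨1, by omega⟩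
    have hcb := one_le_sizeConst ℓ ⟨2, by omega⟩
    have hX : 0 ≤ E ^ (4 * ℓ) * L ^ 2 := by positivity
    rw [mul_assoc] at ha hb
    have ha' := (le_mul_of_one_le_left hX hca).trans ha
    have hb' := (le_mul_of_one_le_left hX hcb).trans hb
    refine le_trans (le_of_eq ?_) (mul_le_mul hb' ha' hX (by positivity))
    rw [show 8 * ℓ = 4 * ℓ + 4 * ℓ by ring, pow_add]
    ring
  · intro h1
    subst h1
    refine ⟨?_, ?_⟩
    · rw [hcard, Fin.sum_univ_two]
      have hlast' : (#(usedNodes S (Fin.succ 1)) : ℝ) = 1 := by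
        have : #(usedNodes S (Fin.last 2)) = 1 := by
          rw [usedNodes_last, card_univ, Fintype.card_fin, hlast]
        exact_mod_cast this
      have hs1 := hsi 1 (by simp)
      have hu0 := hused 0
      rw [hlast', one_mul]
      have hA : (#(usedNodes S (Fin.succ 0)) : ℝ) * s 0
          ≤ (2 * maxSizeConst 1 * E ^ (4 * 1) * L ^ 2) * (2 * maxSizeConst 1 * E ^ (2 * 1) * L) :=
        mul_le_mul hu0 hszero (by positivity) (by positivity)
      have hB : 2 * maxSizeConst 1 * E ^ (4 * 1) * L ^ 2
          ≤ (2 * maxSizeConst 1 * E ^ (4 * 1) * L ^ 2) * (2 * maxSizeConst 1 * E ^ (2 * 1) * L) := by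
        refine le_mul_of_one_le_right (by positivity) ?_
        exact one_le_mul_of_one_le_of_one_le
          (one_le_mul_of_one_le_of_one_le (by linarith) (one_le_pow₀ hE1)) hL
      calc _ ≤ 2 * ((2 * maxSizeConst 1 * E ^ (4 * 1) * L ^ 2) * (2 * maxSizeConst 1 * E ^ (2 * 1) * L)) := by
            linarith
        _ = _ := by push_cast; ring
    · intro henough
      -- the edges between the sampled nodes of layers `0` and `1`
      refine le_trans ?_ (hterm 0)
      rw [card_usedNodes_eq hS (k := Fin.succ 0) (i := 1) rfl, hfull henough, hfull henough, one_mul]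
      have ha := hlow 1 (by simp)
      have hca := one_le_sizeConst 1 0
      have hcb := one_le_sizeConst 1 1
      have hX : 0 ≤ E ^ (4 * 1) * L ^ 2 := by positivity
      have hY : 0 ≤ E ^ (2 * 1) * L := by positivity
      rw [mul_assoc] at ha hlow0
      have ha' := (le_mul_of_one_le_left hX hcb).trans ha
      have hb' := (le_mul_of_one_le_left hY hca).trans hlow0
      refine le_trans (le_of_eq ?_) (mul_le_mul ha' hb' hY (by positivity))
      ring

end Queries

/-! ### Correctness of the testers -/

section Correctness

variable {ℓ : ℕ} {m : Fin (ℓ + 2) → ℕ}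

/-- An event has probability at least `1 - λ` if it holds outside a set of samples of density `λ`. -/
lemma one_sub_le_toReal {c : Fin (ℓ + 1) → ℝ} {ε lam : ℝ} (bad : NodeSample m → Prop)
    [DecidablePred bad] (A : Set (NodeSample m))
    (hbad : (#{S ∈ nodeSamples m (sampleSize m c ε lam) | bad S} : ℝ)
      ≤ lam * #(nodeSamples m (sampleSize m c ε lam)))
    (hA : ∀ S ∈ nodeSamples m (sampleSize m c ε lam), ¬ bad S → S ∈ A) :
    1 - lam ≤ ((PMF.uniformOfFinset (samples m c ε lam)
      (samples_nonempty m c ε lam)).toOuterMeasure A).toReal := by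
  classical
  change (#{S ∈ samples m c ε lam | bad S} : ℝ) ≤ lam * #(samples m c ε lam) at hbad
  change ∀ S ∈ samples m c ε lam, ¬ bad S → S ∈ A at hA
  have hpos : (0 : ℝ) < #(samples m c ε lam) := by
    exact_mod_cast (samples_nonempty m c ε lam).card_pos
  rw [PMF.toOuterMeasure_uniformOfFinset_apply, ENNReal.toReal_div, ENNReal.toReal_natCast,
    ENNReal.toReal_natCast, le_div_iff₀ hpos]
  have h1 : #{S ∈ samples m c ε lam | ¬ bad S} ≤ #{S ∈ samples m c ε lam | S ∈ A} := by
    refine card_le_card fun S hS => ?_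
    rw [mem_filter] at hS ⊢
    exact ⟨hS.1, hA S hS.1 hS.2⟩
  have h2 := card_filter_add_card_filter_not (s := samples m c ε lam) bad
  have h3 : (#{S ∈ samples m c ε lam | bad S} : ℝ) + #{S ∈ samples m c ε lam | ¬ bad S}
      = #(samples m c ε lam) := by exact_mod_cast h2
  have h4 : (#{S ∈ samples m c ε lam | ¬ bad S} : ℝ) ≤ #{S ∈ samples m c ε lam | S ∈ A} := by
    exact_mod_cast h1
  linarith

section Deviation

open scoped Classical

lemma sampleSize_pos (hℓ : 1 ≤ ℓ) (hm : ∀ k : Fin (ℓ + 1), 0 < m k.castSucc) {ε lam : ℝ}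
    (hε0 : 0 < ε) (hε : ε < 1 / 2) (hlam0 : 0 < lam) (hlam : lam < 1 / ((ℓ : ℝ) + 1))
    (k : Fin (ℓ + 1)) : 0 < sampleSize m (sizeConst ℓ) ε lam k :=
  lt_min (nominalSize_pos (one_le_sizeConst ℓ k) hε0
    (one_le_log hε0 hε hlam0 (lam_lt_half hℓ hlam))) (hm k)

lemma error_eq_bias (m : Fin (ℓ + 2) → ℕ) (ε : ℝ) :
    ((ℓ : ℝ) + 1) * ((ε / 2) ^ ℓ / (16 * ((ℓ : ℝ) + 1)) * ∏ i : Fin (ℓ + 1), (m i.castSucc : ℝ))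
      = bias m ε := by
  have hℓ0 : (0 : ℝ) < (ℓ : ℝ) + 1 := by positivity
  unfold bias
  field_simp

/-- With the sample sizes of the testers, all inputs at once are estimated with an error of at most
the bias, relative to the restriction to the sampled input nodes. -/
lemma card_exists_restrict_gt_bias_le (hℓ : 1 ≤ ℓ) (N : ReLUNetwork m)
    (hm : ∀ k : Fin (ℓ + 1), 0 < m k.castSucc) (hlast : m (Fin.last (ℓ + 1)) = 1) {ε lam : ℝ}
    (hε0 : 0 < ε) (hε : ε < 1 / 2) (hlam0 : 0 < lam) (hlam : lam < 1 / ((ℓ : ℝ) + 1)) :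
    (#{S ∈ nodeSamples m (sampleSize m (sizeConst ℓ) ε lam) | ∃ x j,
        bias m ε < |scaledOutput (sampleSize m (sizeConst ℓ) ε lam) N.W S x j
          - (m 0 : ℝ) / sampleSize m (sizeConst ℓ) ε lam 0
              * layerValue N.W (restrictInput (S 0) x) (Fin.last (ℓ + 1)) j|} : ℝ)
      ≤ lam * #(nodeSamples m (sampleSize m (sizeConst ℓ) ε lam)) := by
  have hL := one_le_log hε0 hε hlam0 (lam_lt_half hℓ hlam)
  have hE1 : 1 ≤ 1 / ε := by rw [le_div_iff₀ hε0]; linarith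
  have hC := one_le_maxSizeConst ℓ
  have h := card_exists_scaledOutput_restrict_le N (sampleSize m (sizeConst ℓ) ε lam)
    (sampleSize_pos hℓ hm hε0 hε hlam0 hlam) (fun k => min_le_right _ _) hlast
    (η := (ε / 2) ^ ℓ / (16 * ((ℓ : ℝ) + 1)))
    (M := 2 * maxSizeConst ℓ * (1 / ε) ^ (4 * ℓ) * Real.log (1 / (lam * ε)) ^ 2)
    (lam := lam) (by positivity) hlam0.le
    (one_le_mul_of_one_le_of_one_le
      (one_le_mul_of_one_le_of_one_le (by linarith) (one_le_pow₀ hE1)) (one_le_pow₀ hL))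
    (fun i hi => sampleSize_le_of_ne_zero hε0 hε hL hi) ?_
  · rwa [error_eq_bias] at h
  · intro i hi hlt
    have h1 := two_pow_mul_exp_le hε0 hε hL hi hlt
    refine le_trans ?_ (mul_exp_neg_le hℓ hε0 hε hlam0 hlam)
    rw [mul_comm (2 ^ _), mul_assoc _ (2 ^ _), mul_left_comm (2 ^ _)]
    gcongr

/-- With the sample sizes of the testers, a fixed input is estimated with an error of at most the
bias. -/
lemma card_exists_gt_bias_le (hℓ : 1 ≤ ℓ) (N : ReLUNetwork m)
    (hm : ∀ k : Fin (ℓ + 1), 0 < m k.castSucc) (hlast : m (Fin.last (ℓ + 1)) = 1) {ε lam : ℝ}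
    (hε0 : 0 < ε) (hε : ε < 1 / 2) (hlam0 : 0 < lam) (hlam : lam < 1 / ((ℓ : ℝ) + 1))
    (x : Input m) :
    (#{S ∈ nodeSamples m (sampleSize m (sizeConst ℓ) ε lam) | ∃ j,
        bias m ε < |scaledOutput (sampleSize m (sizeConst ℓ) ε lam) N.W S x j
          - layerValue N.W x (Fin.last (ℓ + 1)) j|} : ℝ)
      ≤ lam * #(nodeSamples m (sampleSize m (sizeConst ℓ) ε lam)) := by
  have hL := one_le_log hε0 hε hlam0 (lam_lt_half hℓ hlam)
  have hE1 : 1 ≤ 1 / ε := by rw [le_div_iff₀ hε0]; linarith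
  have hC := one_le_maxSizeConst ℓ
  have hpos := sampleSize_pos hℓ hm hε0 hε hlam0 hlam
  set s := sampleSize m (sizeConst ℓ) ε lam with hs
  set η := (ε / 2) ^ ℓ / (16 * ((ℓ : ℝ) + 1)) with hη
  have hM1 : 1 ≤ 2 * maxSizeConst ℓ * (1 / ε) ^ (4 * ℓ) * Real.log (1 / (lam * ε)) ^ 2 :=
    one_le_mul_of_one_le_of_one_le
      (one_le_mul_of_one_le_of_one_le (by linarith) (one_le_pow₀ hE1)) (one_le_pow₀ hL)
  have h := card_exists_scaledOutput_le N s hpos x (η := η) (lam := lam) ?_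
  · rwa [error_eq_bias] at h
  · intro i
    have hb := card_badAt_one_le N s x i
      (M := 2 * maxSizeConst ℓ * (1 / ε) ^ (4 * ℓ) * Real.log (1 / (lam * ε)) ^ 2)
      (p := if s i < m i.castSucc then 2 * Real.exp (-(η ^ 2 * s i / 2)) else 0)
      (by split_ifs <;> positivity)
      (fun v j hv => card_sampledSum_gt_le N i v j (hpos i) (min_le_right _ _)
        (by positivity) (layerProd_pos hm _) hv)
      (fun S hS => card_usedNodes_succ_le hS hlast hM1
        (fun i hi => sampleSize_le_of_ne_zero hε0 hε hL hi) i)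
    refine hb.trans (mul_le_mul_of_nonneg_right ?_ (by positivity))
    split_ifs with hlt
    · refine le_trans ?_ (mul_exp_neg_le hℓ hε0 hε hlam0 hlam)
      have hexp : Real.exp (-(η ^ 2 * s i / 2))
          ≤ Real.exp (-(tailExponent ℓ * Real.log (1 / (lam * ε)))) := by
        by_cases hi : i = 0
        · subst hi
          exact Real.exp_le_exp.2 (neg_le_neg (exponent_zero_le hε0 hlt))
        · refine le_trans ?_ (two_pow_mul_exp_le hε0 hε hL hi hlt)
          exact le_mul_of_one_le_left (Real.exp_pos _).le (one_le_pow₀ (by norm_num))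
      gcongr
    · rw [mul_zero]; positivity

end Deviation

/-- The all-zero input produces the output `0`. -/
lemma layerValue_of_forall_false (W : Weights m) {x : Input m} (hx : ∀ t, x t = false)
    (k : Fin (ℓ + 2)) : layerValue W x k = 0 := by
  induction k using Fin.induction with
  | zero => funext t; simp [layerValue_zero, inputVector, hx]
  | succ i ih => funext j; rw [layerValue_succ, ih]; simp

lemma tests_zeroFunction (hℓ : 1 ≤ ℓ) (N : ReLUNetwork m)
    (hm : ∀ k : Fin (ℓ + 1), 0 < m k.castSucc) (hlast : m (Fin.last (ℓ + 1)) = 1) {ε lam δ : ℝ}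
    (hε0 : 0 < ε) (hε : ε < 1 / 2) (hlam0 : 0 < lam) (hlam : lam < 1 / ((ℓ : ℝ) + 1))
    (hclose : (∀ x j, layerValue N.W x (Fin.last (ℓ + 1)) j ≤ 2 * bias m ε) →
      IsClose ε δ N (zeroFunction m)) :
    Tests (allZeroTesterMHL m (sizeConst ℓ) ε lam) (zeroFunction m) ε δ lam N := by
  refine ⟨fun hfar => ?_, fun hN => ?_⟩
  · obtain ⟨x, j, hxj⟩ : ∃ x j, 2 * bias m ε < layerValue N.W x (Fin.last (ℓ + 1)) j := by
      by_contra hno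
      push Not at hno
      exact hfar (hclose hno)
    refine one_sub_le_toReal _ _ (card_exists_gt_bias_le hℓ N hm hlast hε0 hε hlam0 hlam x)
      fun S _ hgood => ?_
    push Not at hgood
    have h1 := neg_le_of_abs_le (hgood j)
    change ¬ (allZeroTesterMHL m (sizeConst ℓ) ε lam).AcceptsOn N S
    rw [allZeroTesterMHL_acceptsOn, not_not]
    exact ⟨x, j, by linarith⟩
  · refine one_sub_le_toReal _ _
      (card_exists_restrict_gt_bias_le hℓ N hm hlast hε0 hε hlam0 hlam) fun S _ hgood => ?_
    push Not at hgood
    change (allZeroTesterMHL m (sizeConst ℓ) ε lam).AcceptsOn N S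
    rw [allZeroTesterMHL_acceptsOn]
    rintro ⟨x, j, hxj⟩
    have h1 := le_of_abs_le (hgood x j)
    have h2 : layerValue N.W (restrictInput (S 0) x) (Fin.last (ℓ + 1)) j ≤ 0 := by
      have := congrFun (congrFun hN (restrictInput (S 0) x)) j
      simpa [ReLUNetwork.computed, zeroFunction] using this
    have h3 := mul_nonpos_of_nonneg_of_nonpos
      (by positivity : (0 : ℝ) ≤ (m 0 : ℝ) / sampleSize m (sizeConst ℓ) ε lam 0) h2
    linarith

lemma tests_orFunction (hℓ : 1 ≤ ℓ) (N : ReLUNetwork m)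
    (hm : ∀ k : Fin (ℓ + 1), 0 < m k.castSucc) (hlast : m (Fin.last (ℓ + 1)) = 1) {ε lam δ : ℝ}
    (hε0 : 0 < ε) (hε : ε < 1 / 2) (hlam0 : 0 < lam) (hlam : lam < 1 / ((ℓ : ℝ) + 1))
    (hclose : (∀ x j, -layerValue N.W x (Fin.last (ℓ + 1)) j ≤ 2 * bias m ε) →
      IsClose ε δ N (orFunction m)) :
    Tests (orTesterMHL m (sizeConst ℓ) ε lam) (orFunction m) ε δ lam N := by
  refine ⟨fun hfar => ?_, fun hN => ?_⟩
  · obtain ⟨x, j, hxj⟩ : ∃ x j, 2 * bias m ε < -layerValue N.W x (Fin.last (ℓ + 1)) j := by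
      by_contra hno
      push Not at hno
      exact hfar (hclose hno)
    refine one_sub_le_toReal _ _ (card_exists_gt_bias_le hℓ N hm hlast hε0 hε hlam0 hlam x)
      fun S _ hgood => ?_
    push Not at hgood
    have h1 := le_of_abs_le (hgood j)
    change ¬ (orTesterMHL m (sizeConst ℓ) ε lam).AcceptsOn N S
    rw [orTesterMHL_acceptsOn, not_not]
    exact ⟨x, j, by linarith⟩
  · refine one_sub_le_toReal _ _
      (card_exists_restrict_gt_bias_le hℓ N hm hlast hε0 hε hlam0 hlam) fun S _ hgood => ?_
    push Not at hgood
    change (orTesterMHL m (sizeConst ℓ) ε lam).AcceptsOn N S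
    rw [orTesterMHL_acceptsOn]
    rintro ⟨x, j, hxj⟩
    have h1 := neg_le_of_abs_le (hgood x j)
    have h2 : 0 ≤ layerValue N.W (restrictInput (S 0) x) (Fin.last (ℓ + 1)) j := by
      by_cases hx : ∃ t, restrictInput (S 0) x t = true
      · have := congrFun (congrFun hN (restrictInput (S 0) x)) j
        simp only [ReLUNetwork.computed, orFunction, hx, decide_true, decide_eq_true_eq] at this
        exact this.le
      · push Not at hx
        rw [layerValue_of_forall_false N.W fun t => by simpa using hx t]
        exact le_rfl
    have h3 := mul_nonneg
      (by positivity : (0 : ℝ) ≤ (m 0 : ℝ) / sampleSize m (sizeConst ℓ) ε lam 0) h2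
    linarith

/-- Both testers are correct for all `δ` such that the layers are large enough for the modification of
networks with small outputs. -/
lemma tests_of_layerLarge (hℓ : 1 ≤ ℓ) (N : ReLUNetwork m)
    (hm : ∀ k : Fin (ℓ + 1), 0 < m k.castSucc) (hlast : m (Fin.last (ℓ + 1)) = 1)
    {ε lam lamStar δ : ℝ}
    (hε0 : 0 < ε) (hε : ε < 1 / 2) (hlam0 : 0 < lam) (hlam : lam < 1 / ((ℓ : ℝ) + 1))
    (hstar0 : 0 < lamStar) (hstar : lamStar < 1 / ((ℓ : ℝ) + 1))
    (hlarge : ∀ i ≠ 0, LayerLarge m ε lamStar i)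
    (hδ : lamStar + Real.exp (-(m 0 : ℝ) / 16) ≤ δ) :
    Tests (allZeroTesterMHL m (sizeConst ℓ) ε lam) (zeroFunction m) ε δ lam N ∧
    Tests (orTesterMHL m (sizeConst ℓ) ε lam) (orFunction m) ε δ lam N := by
  have hbias : 2 * bias m ε = 1 / 8 * ((ε / 2) ^ ℓ * ∏ i : Fin (ℓ + 1), (m i.castSucc : ℝ)) := by
    unfold bias; ring
  refine ⟨tests_zeroFunction hℓ N hm hlast hε0 hε hlam0 hlam fun hsmall => ?_,
    tests_orFunction hℓ N hm hlast hε0 hε hlam0 hlam fun hsmall => ?_⟩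
  · refine isClose_of_forall_le hℓ N hm hlast hε0 hε hstar0 hstar hlarge hδ (σ := 1) (by norm_num)
      _ (fun N' x _ hneg => ?_) fun x j => ?_
    · funext j
      have := hneg j
      rw [one_mul] at this
      simpa [ReLUNetwork.computed, zeroFunction] using this.le
    · rw [one_mul, ← hbias]
      exact hsmall x j
  · refine isClose_of_forall_le hℓ N hm hlast hε0 hε hstar0 hstar hlarge hδ (σ := -1) (by norm_num)
      _ (fun N' x hx hneg => ?_) fun x j => ?_
    · funext j
      have hpos : 0 < layerValue N'.W x (Fin.last (ℓ + 1)) j := by linarith [hneg j]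
      obtain ⟨t, ht⟩ := card_pos.1 hx
      have hor : ∃ t, x t = true := ⟨t, by simpa using ht⟩
      simp [ReLUNetwork.computed, orFunction, hpos, hor]
    · rw [neg_one_mul, ← hbias]
      exact hsmall x j

lemma isClose_of_one_le (N : ReLUNetwork m) (f : Input m → Output m) {ε δ : ℝ} (hε0 : 0 < ε)
    (hδ : 1 ≤ δ) : IsClose ε δ N f := by
  refine ⟨N, fun i => ?_, le_trans ?_ hδ⟩
  · simp only [ne_eq, not_true_eq_false, filter_false, card_empty, Nat.cast_zero]
    positivity
  · unfold disagreement
    rw [div_le_one (by positivity)]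
    have h := card_filter_le (univ : Finset (Input m)) fun x => N.computed x ≠ f x
    rw [card_univ, Fintype.card_fun, Fintype.card_fin, Fintype.card_bool] at h
    exact_mod_cast h

/-- For layers of the same size `n` and `δ < 1`, a suitable `λ*` is `δ / 2`, or `1 / (ℓ + 2)` if that
is smaller. The condition on `n` forces `e^(-n/16) ≤ δ / 2`. -/
lemma exists_lamStar (hℓ : 1 ≤ ℓ) {n : ℕ} (hn : 0 < n) (hmn : ∀ k : Fin (ℓ + 1), m k.castSucc = n)
    {ε δ : ℝ} (hε0 : 0 < ε) (hε : ε < 1 / 2) (hδ0 : 0 < δ) (hδ1 : δ < 1)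
    (hlarge : 171 * ((ℓ : ℝ) + 1) ^ 2 * (2 / ε) ^ (2 * ℓ)
            * (Real.log (2 / δ) + (ℓ : ℝ) * Real.log (n : ℝ)) ≤ (n : ℝ)) :
    ∃ lamStar : ℝ, 0 < lamStar ∧ lamStar < 1 / ((ℓ : ℝ) + 1) ∧
      (∀ i ≠ 0, LayerLarge m ε lamStar i) ∧ lamStar + Real.exp (-(m 0 : ℝ) / 16) ≤ δ := by
  have hm0 : m 0 = n := hmn 0
  have hn1 : (1 : ℝ) ≤ n := by exact_mod_cast hn
  have hℓ1 : (1 : ℝ) ≤ ℓ := by exact_mod_cast hℓ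
  have hlogn : 0 ≤ Real.log n := Real.log_nonneg hn1
  have h2δ : 2 ≤ 2 / δ := by rw [le_div_iff₀ hδ0]; linarith
  have hlogδ : 69 / 100 ≤ Real.log (2 / δ) :=
    le_trans (by linarith [Real.log_two_gt_d9]) (Real.log_le_log (by norm_num) h2δ)
  have hpow : 1 ≤ (2 / ε) ^ (2 * ℓ) := one_le_pow₀ (by rw [le_div_iff₀ hε0]; linarith)
  have hbase : 171 * ((ℓ : ℝ) + 1) ^ 2 * Real.log (2 / δ) ≤ n := by
    refine le_trans ?_ hlarge
    have h1 : 171 * ((ℓ : ℝ) + 1) ^ 2 ≤ 171 * ((ℓ : ℝ) + 1) ^ 2 * (2 / ε) ^ (2 * ℓ) :=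
      le_mul_of_one_le_right (by positivity) hpow
    have h2 : Real.log (2 / δ) ≤ Real.log (2 / δ) + (ℓ : ℝ) * Real.log n := by
      have := mul_nonneg (by linarith : (0 : ℝ) ≤ ℓ) hlogn
      linarith
    exact mul_le_mul h1 h2 (by linarith) (by positivity)
  have hnℓ : (ℓ : ℝ) + 2 ≤ n := by nlinarith
  have hexp : Real.exp (-(n : ℝ) / 16) ≤ δ / 2 := by
    rw [← Real.le_log_iff_exp_le (by positivity), show δ / 2 = (2 / δ)⁻¹ by rw [inv_div],
      Real.log_inv]
    have h16 : 16 * Real.log (2 / δ) ≤ 171 * ((ℓ : ℝ) + 1) ^ 2 * Real.log (2 / δ) :=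
      mul_le_mul_of_nonneg_right (by nlinarith) (by linarith)
    linarith
  refine ⟨min (δ / 2) (1 / ((ℓ : ℝ) + 2)), by positivity, ?_, ?_, ?_⟩
  · exact (min_le_right _ _).trans_lt (one_div_lt_one_div_of_lt (by positivity) (by linarith))
  · intro i hi
    unfold LayerLarge
    rw [hmn i]
    refine le_trans (mul_le_mul_of_nonneg_left ?_ (by positivity)) hlarge
    have hprod : ∏ k ∈ Finset.Ioi i, (m k.castSucc : ℝ) ≤ (n : ℝ) ^ (ℓ - 1) := by
      rw [prod_congr rfl fun k _ => by rw [hmn k], prod_const, Fin.card_Ioi]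
      have hi' : i.val ≠ 0 := fun h => hi (Fin.ext h)
      exact pow_le_pow_right₀ hn1 (by omega)
    have hprod0 : 0 < ∏ k ∈ Finset.Ioi i, (m k.castSucc : ℝ) :=
      prod_pos fun k _ => by rw [hmn k]; linarith
    have hinv : 1 / min (δ / 2) (1 / ((ℓ : ℝ) + 2)) ≤ 2 / δ * n := by
      rcases min_choice (δ / 2) (1 / ((ℓ : ℝ) + 2)) with h | h
      · rw [h, one_div_div]
        exact le_mul_of_one_le_right (by positivity) hn1
      · rw [h, one_div_one_div]
        nlinarith
    have hmin : 0 < min (δ / 2) (1 / ((ℓ : ℝ) + 2)) := by positivity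
    have hle : 1 / min (δ / 2) (1 / ((ℓ : ℝ) + 2)) * ∏ k ∈ Finset.Ioi i, (m k.castSucc : ℝ)
        ≤ 2 / δ * (n : ℝ) ^ ℓ := by
      refine (mul_le_mul hinv hprod hprod0.le (by positivity)).trans (le_of_eq ?_)
      rw [mul_assoc, ← pow_succ', Nat.sub_add_cancel hℓ]
    refine (Real.log_le_log (by positivity) hle).trans (le_of_eq ?_)
    rw [Real.log_mul (by positivity) (by positivity), Real.log_pow]
  · rw [hm0]
    have := min_le_left (δ / 2) (1 / ((ℓ : ℝ) + 2))
    linarith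

end Correctness

end ReLUTest

theorem mainTheorem7 (ℓ : ℕ) (hℓ : 1 ≤ ℓ) :
    ∃ (c : Fin (ℓ + 1) → ℝ) (a b : ℝ), (∀ k, 0 < c k) ∧ 0 < a ∧ 0 < b ∧
      -- number of queries, for every outcome of the random choices of the tester
      (∀ (m : Fin (ℓ + 2) → ℕ) (ε lam : ℝ),
        m (Fin.last (ℓ + 1)) = 1 →
        (∀ k : Fin (ℓ + 1), 0 < m k.castSucc ∧ 1 / (m k.castSucc : ℝ) < ε) → ε < 1 / 2 →
        0 < lam → lam < 1 / ((ℓ : ℝ) + 1) →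
        (∀ ω ∈ (ReLUTest.allZeroTesterMHL m c ε lam).coins.support,
          ReLUTest.QueryBound ℓ a b ε lam
            (∀ k, ReLUTest.nominalSize c ε lam k ≤ m k.castSucc)
            ((ReLUTest.allZeroTesterMHL m c ε lam).queries ω).card) ∧
        (∀ ω ∈ (ReLUTest.orTesterMHL m c ε lam).coins.support,
          ReLUTest.QueryBound ℓ a b ε lam
            (∀ k, ReLUTest.nominalSize c ε lam k ≤ m k.castSucc)
            ((ReLUTest.orTesterMHL m c ε lam).queries ω).card)) ∧
      -- correctness, layers of arbitrary sizes
      (∀ (m : Fin (ℓ + 2) → ℕ) (ε lam lamStar δ : ℝ) (N : ReLUTest.ReLUNetwork m),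
        m (Fin.last (ℓ + 1)) = 1 →
        (∀ k : Fin (ℓ + 1), 0 < m k.castSucc ∧ 1 / (m k.castSucc : ℝ) < ε) → ε < 1 / 2 →
        0 < lam → lam < 1 / ((ℓ : ℝ) + 1) →
        0 < lamStar → lamStar < 1 / ((ℓ : ℝ) + 1) →
        ReLUTest.LayersLarge m ε lamStar →
        lamStar + Real.exp (-(m 0 : ℝ) / 16) ≤ δ →
        ReLUTest.Tests (ReLUTest.allZeroTesterMHL m c ε lam) (ReLUTest.zeroFunction m) ε δ lam N ∧
        ReLUTest.Tests (ReLUTest.orTesterMHL m c ε lam) (ReLUTest.orFunction m) ε δ lam N) ∧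
      -- correctness, simplified form for layers of the same size
      (∀ (n : ℕ) (m : Fin (ℓ + 2) → ℕ) (ε lam δ : ℝ) (N : ReLUTest.ReLUNetwork m),
        m (Fin.last (ℓ + 1)) = 1 →
        (∀ k : Fin (ℓ + 1), m k.castSucc = n) → 0 < n →
        1 / (n : ℝ) < ε → ε < 1 / 2 →
        0 < lam → lam < 1 / ((ℓ : ℝ) + 1) →
        Real.exp (-(n : ℝ) / 16)
            + Real.exp (-((ε / 2) ^ ℓ * (n : ℝ) / (342 * ((ℓ : ℝ) + 1) ^ 2))) ≤ δ →
        171 * ((ℓ : ℝ) + 1) ^ 2 * (2 / ε) ^ (2 * ℓ)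
            * (Real.log (2 / δ) + (ℓ : ℝ) * Real.log (n : ℝ)) ≤ (n : ℝ) →
        ReLUTest.Tests (ReLUTest.allZeroTesterMHL m c ε lam) (ReLUTest.zeroFunction m) ε δ lam N ∧
        ReLUTest.Tests (ReLUTest.orTesterMHL m c ε lam) (ReLUTest.orFunction m) ε δ lam N) := by
  have hεpos : ∀ {n : ℕ} {ε : ℝ}, 1 / (n : ℝ) < ε → 0 < ε := fun h =>
    lt_of_le_of_lt (by positivity) h
  refine ⟨ReLUTest.sizeConst ℓ, 1, ((ℓ : ℝ) + 1) * (2 * ReLUTest.maxSizeConst ℓ) ^ 2,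
    fun k => lt_of_lt_of_le one_pos (ReLUTest.one_le_sizeConst ℓ k), one_pos, ?_, ?_, ?_, ?_⟩
  · have := ReLUTest.one_le_maxSizeConst ℓ
    positivity
  · intro m ε lam hlast hm hε hlam0 hlam
    have hε0 := hεpos (hm 0).2
    exact ⟨fun S hS => ReLUTest.queryBound_inducedEdges hℓ hlast hε0 hε hlam0 hlam
        ((PMF.mem_support_uniformOfFinset_iff (ReLUTest.samples_nonempty m _ ε lam) S).1 hS),
      fun S hS => ReLUTest.queryBound_inducedEdges hℓ hlast hε0 hε hlam0 hlam
        ((PMF.mem_support_uniformOfFinset_iff (ReLUTest.samples_nonempty m _ ε lam) S).1 hS)⟩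
  · intro m ε lam lamStar δ N hlast hm hε hlam0 hlam hstar0 hstar hlarge hδ
    refine ReLUTest.tests_of_layerLarge hℓ N (fun k => (hm k).1) hlast (hεpos (hm 0).2) hε hlam0
      hlam hstar0 hstar (fun i hi => hlarge.2 i ?_) hδ
    exact Nat.one_le_iff_ne_zero.2 fun h => hi (Fin.ext h)
  · intro n m ε lam δ N hlast hmn hn hnε hε hlam0 hlam hδ hlarge
    have hε0 := hεpos hnε
    have hm : ∀ k : Fin (ℓ + 1), 0 < m k.castSucc := fun k => (hmn k).symm ▸ hn
    rcases le_or_gt 1 δ with h1 | h1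
    · exact ⟨ReLUTest.tests_zeroFunction hℓ N hm hlast hε0 hε hlam0 hlam fun _ =>
          ReLUTest.isClose_of_one_le N _ hε0 h1,
        ReLUTest.tests_orFunction hℓ N hm hlast hε0 hε hlam0 hlam fun _ =>
          ReLUTest.isClose_of_one_le N _ hε0 h1⟩
    · have hδ0 : 0 < δ := lt_of_lt_of_le (by positivity) hδ
      obtain ⟨lamStar, hstar0, hstar, hL, hδ'⟩ :=
        ReLUTest.exists_lamStar hℓ hn hmn hε0 hε hδ0 h1 hlarge
      exact ReLUTest.tests_of_layerLarge hℓ N hm hlast hε0 hε hlam0 hlam hstar0 hstar hL hδ'
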